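/- Let $d\ge 2$ and let $\theta=(\theta_{jk})_{j,k=1}^d$ be a nonsingular real skew-symmetric $d\times d$ matrix. Let $(P_1,\dots,P_d)$ be a tuple of (possibly unbounded) self-adjoint operators on a nonzero complex Hilbert space $H$ which is a representation of the Heisenberg relations $[P_j,P_k]=-i\theta_{jk}I$, in the sense that $$e^{iP_js}e^{iP_kt}=e^{ist\theta_{jk}}\,e^{iP_kt}e^{iP_js}\qquad\text{for all } s,t\in\mathbb R,\ 1\le j,k\le d.$$ Suppose that this representation has finite multiplicity, i.e. that it is unitarily equivalent to a direct sum of finitely many copies of an irreducible representation of the same relations (irreducible: on a nonzero Hilbert space, with no nontrivial closed subspace invariant under all the associated unitaries $e^{iP_js}$). Then there is no tuple $(P_1',\dots,P_d')$ of strongly commuting self-adjoint operators on $H$ (that is, $e^{iP_j's}e^{iP_k't}=e^{iP_k't}e^{iP_j's}$ for all $s,t\in\mathbb R$ and all $j,k$) such that $P_j-P_j'$ is bounded for every $j=1,\dots,d$, i.e. such that for every $j$ the operators $P_j$ and $P_j'$ have the same domain and $P_j-P_j'$ is bounded on it. -/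

import Mathlib

namespace Weyl

universe u v

variable {H : Type u} [NormedAddCommGroup H] [InnerProductSpace ℂ H] [CompleteSpace H]
  {K : Type v} [NormedAddCommGroup K] [InnerProductSpace ℂ K] [CompleteSpace K] {d : ℕ}

/-- `U` is the strongly continuous one-parameter unitary group `U t = e^{iPt}` generated by the
(possibly unbounded) operator `P`: the domain of `P` consists of the vectors `x` for which
`t ↦ U t x` is differentiable at `0`, and there the derivative is `i P x`. (By Stone's theorem every
self-adjoint `P` has exactly one such `U`.) -/
structure IsUnitaryGroupOf (P : H →ₗ.[ℂ] H) (U : ℝ → H →L[ℂ] H) : Prop where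
  unitary : ∀ t, U t ∈ unitary (H →L[ℂ] H)
  zero : U 0 = 1
  add : ∀ s t, U (s + t) = U s * U t
  continuous : ∀ x, Continuous fun t => U t x
  generator : ∀ x y : H, (x, y) ∈ P.graph ↔ HasDerivAt (fun t => U t x) (Complex.I • y) 0

/-- The tuple `P` of self-adjoint operators satisfies the Heisenberg relations
`[P j, P k] = -i θ j k I` in the Weyl sense:
`e^{i P_j s} e^{i P_k t} = e^{i s t θ_{jk}} e^{i P_k t} e^{i P_j s}`. -/
def IsHeisenbergRep (θ : Matrix (Fin d) (Fin d) ℝ) (P : Fin d → H →ₗ.[ℂ] H) : Prop :=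
  (∀ j, IsSelfAdjoint (P j)) ∧
    ∃ U : Fin d → ℝ → H →L[ℂ] H, (∀ j, IsUnitaryGroupOf (P j) (U j)) ∧
      ∀ j k s t, U j s * U k t =
        Complex.exp (Complex.I * ((s * t * θ j k : ℝ) : ℂ)) • (U k t * U j s)

/-- The tuple `P` consists of strongly commuting self-adjoint operators: the one-parameter
unitary groups that they generate commute. -/
def IsStronglyCommuting (P : Fin d → H →ₗ.[ℂ] H) : Prop :=
  (∀ j, IsSelfAdjoint (P j)) ∧
    ∃ U : Fin d → ℝ → H →L[ℂ] H, (∀ j, IsUnitaryGroupOf (P j) (U j)) ∧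
      ∀ j k s t, U j s * U k t = U k t * U j s

/-- Irreducibility of a tuple of self-adjoint operators: the space is nonzero, and the only closed
subspaces invariant under all the unitaries `e^{i P_j s}` are the trivial ones. -/
def IsIrreducibleTuple (P : Fin d → H →ₗ.[ℂ] H) : Prop :=
  Nontrivial H ∧ ∀ V : Submodule ℂ H, IsClosed (V : Set H) →
    (∀ j, ∃ U : ℝ → H →L[ℂ] H, IsUnitaryGroupOf (P j) U ∧ ∀ s, ∀ x ∈ V, U s x ∈ V) →
    V = ⊥ ∨ V = ⊤

/-- `P` is unitarily equivalent to the `M`-fold multiple of `Q`, the componentwise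
action of `Q` on the Hilbert space direct sum of `M` copies of `K`. -/
def IsMultipleOf (P : Fin d → H →ₗ.[ℂ] H) (M : ℕ) (Q : Fin d → K →ₗ.[ℂ] K) : Prop :=
  ∃ W : H ≃ₗᵢ[ℂ] PiLp 2 (fun _ : Fin M => K),
    ∀ j, ∀ x y : H, (x, y) ∈ (P j).graph ↔ ∀ m, (W x m, W y m) ∈ (Q j).graph

/-- The representation `P` of the Heisenberg relations with parameter `θ` has finite multiplicity:
it is unitarily equivalent to a finite multiple of an irreducible representation. -/
def HasFiniteMultiplicity (θ : Matrix (Fin d) (Fin d) ℝ) (P : Fin d → H →ₗ.[ℂ] H) : Prop :=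
  ∃ (M : ℕ) (K : Type u) (_ : NormedAddCommGroup K) (_ : InnerProductSpace ℂ K)
    (_ : CompleteSpace K) (Q : Fin d → K →ₗ.[ℂ] K),
    IsHeisenbergRep θ Q ∧ IsIrreducibleTuple Q ∧ IsMultipleOf P M Q

/-- The difference of the unbounded operators `A` and `B` is bounded: the domains coincide
and `A - B` is a bounded operator on the common domain. -/
def HasBoundedDifference (A B : H →ₗ.[ℂ] H) : Prop :=
  A.domain = B.domain ∧
    ∃ C : ℝ, ∀ (x : A.domain) (y : B.domain), (x : H) = y → ‖A x - B y‖ ≤ C * ‖(x : H)‖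

end Weyl

/-!
The proof is an index argument. Let `e` be a symplectic basis for the form `θ` and let `p α` be the
generator `∑ j, e α j • P j`, so that the `p α` are `n` canonical pairs. With Clifford matrices
`C α` from one half-spinor space to the other, consider the Dirac operator `T = ∑ α, C α ⊗ p α` on
the common domain `D` of the `P j` (`diracMap`).

For the representation `P` this operator has a nonzero index. The Weitzenböck formula
(`IsCliffordFamily.norm_sq_diracMap`) splits `‖T ψ‖²` into harmonic oscillators `p² + q² ∓ 1`, where
by chirality every spinor component has a mode with the positive shift; since `p² + q² ≥ 1`, `T` is
injective (`IsCliffordFamily.eq_zero_of_diracMap_eq_zero`). On the other half-spinor space there is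
a component in which all shifts are negative, and the vacuum vector placed there is orthogonal to
the range of `T` (`IsCliffordFamily.inner_vacuum_diracMap`), which is therefore not surjective.

For a strongly commuting tuple `P'` at bounded distance from `P` the index vanishes. The cross terms
in the Weitzenböck formula cancel (`norm_sq_diracMap`), so that the Dirac operator `T'` of `P'` is
injective with closed range as soon as `P'` has no joint kernel. A translation of `P'` by a multiple
of the identity, which is a bounded perturbation, achieves this
(`IsCommutingTuple.exists_not_joint_eigenvalue`). A vector orthogonal to the range of `T'` can be
mollified by functions of `P'` into a zero mode of the adjoint Dirac operator, which is injective
for the same reason. So `T'` is bijective, and its inverse is compact because `D` with the graph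
norm embeds compactly into `H` (`IsCommutingTuple.exists_compact_inverse`). Now `T T'⁻¹` is the sum
of the identity and a compact operator, and by the Fredholm alternative the injective operator `T`
is surjective (`surjective_diracMap_of_bounded_sub`), a contradiction.

The vacuum vectors and the compactness of the embedding come from von Neumann's treatment of the
canonical commutation relations. The one-parameter groups combine into a Weyl system `W`
(`exists_isWeylSystem`), and `∫ e^{-‖z‖²/4} W(z) dz` is a multiple of the projection onto the vacuum
vectors (`IsWeylSystem.smear_gaussian_apply_smear_gaussian`). Averaging its conjugates by a Gaussian
gives `∫ e^{-β‖z‖²} W(z) dz` with `β` arbitrarily large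
(`IsWeylSystem.integral_gaussian_smul_conj_smear`), an approximate identity. Hence the projection
does not vanish. If `W` is irreducible the projection has rank one, the averages are compact, and
they approximate the identity uniformly on the balls of the graph norm
(`IsWeylSystem.totallyBounded_of_norm_apply_sub_le`). Finite multiplicity carries the compactness
over to `P`.
-/

namespace Weyl

open Complex (I)
open MeasureTheory Filter Topology
open scoped InnerProductSpace Convolution Matrix

/-! ### Symplectic bases -/

/-- Adjoin to the family `e` a vector `u` outside of its span and a conjugate vector `v`, both of
them symplectically orthogonal to `e`. -/
theorem exists_symplectic_extension {V : Type*} [AddCommGroup V] [Module ℝ V]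
    (B : V →ₗ[ℝ] V →ₗ[ℝ] ℝ) (halt : B.IsAlt) (hnd : ∀ x, x ≠ 0 → ∃ y, B x y ≠ 0)
    {n : ℕ} (e : Fin n ⊕ Fin n → V) (he : ∀ α β, B (e α) (e β) = Matrix.J (Fin n) ℝ α β)
    (hspan : Submodule.span ℝ (Set.range e) ≠ ⊤) :
    ∃ e' : Fin (n + 1) ⊕ Fin (n + 1) → V,
      (∀ α β, B (e' α) (e' β) = Matrix.J (Fin (n + 1)) ℝ α β) ∧
      Submodule.span ℝ (Set.range e) < Submodule.span ℝ (Set.range e') := by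
  have hneg : ∀ x y, B x y = -B y x := fun x y => by rw [← halt.neg]
  set S := Submodule.span ℝ (Set.range e) with hS
  have hmem : ∀ α, e α ∈ S := fun α => Submodule.subset_span ⟨α, rfl⟩
  -- symplectic orthogonalization against `e`
  have horth : ∀ x, ∃ x', x - x' ∈ S ∧ ∀ α, B x' (e α) = 0 := by
    intro x
    refine ⟨x - ∑ a, (-(B x (e (.inr a))) • e (.inl a) + B x (e (.inl a)) • e (.inr a)), ?_, ?_⟩
    · rw [sub_sub_cancel]
      exact Submodule.sum_mem _ fun a _ =>
        S.add_mem (S.smul_mem _ (hmem _)) (S.smul_mem _ (hmem _))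
    · rintro (b | b) <;>
      simp [he, Matrix.J, Finset.sum_add_distrib, Matrix.one_apply]
  have hS0 : ∀ x', (∀ α, B x' (e α) = 0) → ∀ y ∈ S, B x' y = 0 := by
    intro x' hx' y hy
    have : S ≤ LinearMap.ker (B x') := by
      rw [hS, Submodule.span_le]
      rintro _ ⟨α, rfl⟩
      exact hx' α
    exact this hy
  obtain ⟨x, hx⟩ : ∃ x, x ∉ S := by
    by_contra! h
    exact hspan (Submodule.eq_top_iff'.2 h)
  obtain ⟨u, hxu, hu⟩ := horth x
  have huS : u ∉ S := fun h => hx (by simpa using S.add_mem hxu h)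
  obtain ⟨y, hy⟩ := hnd u (fun h => huS (h ▸ S.zero_mem))
  obtain ⟨w, hyw, hw⟩ := horth y
  have huw : B u w ≠ 0 := by
    have h1 := hS0 u hu _ hyw
    rw [map_sub, sub_eq_zero] at h1
    rwa [← h1]
  set v := (-(B u w)⁻¹) • w with hv
  have huv : B u v = -1 := by simp [hv, huw]
  have hvu : B v u = 1 := by rw [hneg, huv, neg_neg]
  have hve : ∀ α, B v (e α) = 0 := fun α => by simp [hv, hw]
  have heu : ∀ α, B (e α) u = 0 := fun α => by rw [hneg, hu, neg_zero]
  have hev : ∀ α, B (e α) v = 0 := fun α => by rw [hneg, hve, neg_zero]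
  refine ⟨Sum.elim (Fin.cons u (e ∘ .inl)) (Fin.cons v (e ∘ .inr)), ?_, ?_⟩
  · rintro (α | α) (β | β) <;> refine Fin.cases ?_ (fun a => ?_) α <;>
      refine Fin.cases ?_ (fun b => ?_) β <;>
      simp [Matrix.J, Matrix.one_apply, he, hu, hve, heu, hev, huv, hvu, halt.self_eq_zero,
        (Fin.succ_ne_zero _).symm]
  · refine lt_of_le_of_ne (Submodule.span_mono ?_) ?_
    · rintro _ ⟨α | α, rfl⟩
      · exact ⟨.inl α.succ, by simp⟩
      · exact ⟨.inr α.succ, by simp⟩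
    · intro h
      exact huS (h ▸ Submodule.subset_span ⟨.inl 0, by simp⟩)

/-- A nondegenerate alternating form has a symplectic basis. In the sign convention of `Matrix.J`
the conjugate pairs satisfy `B (e (inl a)) (e (inr a)) = -1`; linear independence of `e` follows
from the Gram matrix and is never needed as such. -/
theorem exists_symplectic_spanning_family {V : Type*} [AddCommGroup V] [Module ℝ V]
    [FiniteDimensional ℝ V]
    (B : V →ₗ[ℝ] V →ₗ[ℝ] ℝ) (halt : B.IsAlt) (hnd : ∀ x, x ≠ 0 → ∃ y, B x y ≠ 0) :
    ∃ (n : ℕ) (e : Fin n ⊕ Fin n → V), (∀ α β, B (e α) (e β) = Matrix.J (Fin n) ℝ α β) ∧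
      Submodule.span ℝ (Set.range e) = ⊤ := by
  by_contra! hcon
  have key : ∀ k : ℕ, ∃ (n : ℕ) (e : Fin n ⊕ Fin n → V),
      (∀ α β, B (e α) (e β) = Matrix.J (Fin n) ℝ α β) ∧
      k ≤ Module.finrank ℝ (Submodule.span ℝ (Set.range e)) := by
    intro k
    induction k with
    | zero => exact ⟨0, fun _ => 0, by rintro (α | α) <;> exact α.elim0, Nat.zero_le _⟩
    | succ k ih =>
      obtain ⟨n, e, he, hk⟩ := ih
      obtain ⟨e', he', hlt⟩ := exists_symplectic_extension B halt hnd e he (hcon n e he)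
      exact ⟨n + 1, e', he', lt_of_le_of_lt hk (Submodule.finrank_lt_finrank_of_lt hlt)⟩
  obtain ⟨n, e, -, hk⟩ := key (Module.finrank ℝ V + 1)
  exact absurd (Submodule.finrank_le (Submodule.span ℝ (Set.range e))) (by omega)

/-! ### Clifford matrices -/

open Matrix in
/-- The Clifford multiplication from one half-spinor space to the other, for an even number of
generators grouped in pairs: the Hermitian matrices with off-diagonal blocks `C α` and `(C α)ᴴ`
anticommute and square to `1`. The basis `ι`, common to both half-spinor spaces, diagonalizes the
products over each pair `inl a`, `inr a`, with signs `s a` on the target and `s' a` on the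
source. -/
structure IsCliffordFamily {κ ι : Type*} [DecidableEq κ] [Fintype ι] [DecidableEq ι]
    (C : κ ⊕ κ → Matrix ι ι ℂ) (s s' : κ → ι → ℤˣ) : Prop where
  conjTranspose_mul : ∀ α β, (C α)ᴴ * C β + (C β)ᴴ * C α = if α = β then 2 else 0
  mul_conjTranspose : ∀ α β, C α * (C β)ᴴ + C β * (C α)ᴴ = if α = β then 2 else 0
  sign : ∀ a, C (.inl a) * (C (.inr a))ᴴ =
    Complex.I • diagonal fun i => (((s a i : ℤˣ) : ℤ) : ℂ)
  sign' : ∀ a, (C (.inl a))ᴴ * C (.inr a) =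
    Complex.I • diagonal fun i => (((s' a i : ℤˣ) : ℤ) : ℂ)

open Matrix in
/-- By chirality, the signs multiply to `1` on one half-spinor space and to `-1` on the other. Hence
the configuration with all signs `1` occurs among the `s`, but not among the `s'`; this asymmetry
is what makes the index of the Dirac operator nonzero. The construction adds one pair of generators
at a time, doubling the spinor spaces. -/
theorem exists_isCliffordFamily (n : ℕ) :
    ∃ (ι : Type) (_ : Fintype ι) (_ : DecidableEq ι)
      (C : Fin (n + 1) ⊕ Fin (n + 1) → Matrix ι ι ℂ) (s s' : Fin (n + 1) → ι → ℤˣ),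
      IsCliffordFamily C s s' ∧ (∃ i, ∀ a, s a i = 1) ∧
        (∀ i, ∏ a, s a i = 1) ∧ ∀ i, ∏ a, s' a i = -1 := by
  induction n with
  | zero =>
    refine ⟨Unit, inferInstance, inferInstance,
      Sum.elim (fun _ => 1) (fun _ => -(Complex.I • 1)), fun _ _ => 1, fun _ _ => -1,
      ⟨?_, ?_, ?_, ?_⟩, ⟨(), fun _ => rfl⟩, by simp, by simp⟩
    · rintro (α | α) (β | β) <;> fin_cases α <;> fin_cases β <;>
        simp [smul_smul, one_add_one_eq_two]
    · rintro (α | α) (β | β) <;> fin_cases α <;> fin_cases β <;>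
        simp [smul_smul, one_add_one_eq_two]
    · intro a; ext; simp
    · intro a; ext; simp
  | succ n ih =>
    obtain ⟨ι, hι, hι', C, s, s', hC, ⟨i₀, hi₀⟩, hs, hs'⟩ := ih
    have h1 := hC.conjTranspose_mul
    have h2 := hC.mul_conjTranspose
    have h3 := hC.sign
    have h4 := hC.sign'
    have h11 : fromBlocks ((1 : Matrix ι ι ℂ) + 1) 0 0 ((1 : Matrix ι ι ℂ) + 1) = 2 := by
      rw [← one_add_one_eq_two (R := Matrix (ι ⊕ ι) (ι ⊕ ι) ℂ), ← fromBlocks_one, fromBlocks_add]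
      simp
    have hblock : ∀ (p : Prop) [Decidable p], fromBlocks (if p then (2 : Matrix ι ι ℂ) else 0) 0 0
        (if p then (2 : Matrix ι ι ℂ) else 0) = if p then 2 else 0 := by
      intro p _
      split_ifs
      · rw [← h11, one_add_one_eq_two]
      · simp
    refine ⟨ι ⊕ ι, inferInstance, inferInstance,
      Sum.elim
        (Fin.cons (fromBlocks 0 1 (-1) 0) fun a => fromBlocks (C (.inl a)) 0 0 (C (.inl a))ᴴ)
        (Fin.cons (fromBlocks 0 (-(Complex.I • 1)) (-(Complex.I • 1)) 0)
          fun a => fromBlocks (C (.inr a)) 0 0 (C (.inr a))ᴴ),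
      Fin.cons (Sum.elim 1 (-1)) fun a => Sum.elim (s a) (s' a),
      Fin.cons (Sum.elim 1 (-1)) fun a => Sum.elim (s' a) (s a),
      ⟨?_, ?_, ?_, ?_⟩, ⟨.inl i₀, ?_⟩, ?_, ?_⟩
    · rintro (α | α) (β | β) <;> refine Fin.cases ?_ (fun a => ?_) α <;>
        refine Fin.cases ?_ (fun b => ?_) β <;>
        simp [fromBlocks_conjTranspose, fromBlocks_multiply, fromBlocks_add, h1, h2, smul_smul,
          (Fin.succ_ne_zero _).symm, hblock, one_add_one_eq_two]
    · rintro (α | α) (β | β) <;> refine Fin.cases ?_ (fun a => ?_) α <;>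
        refine Fin.cases ?_ (fun b => ?_) β <;>
        simp [fromBlocks_conjTranspose, fromBlocks_multiply, fromBlocks_add, h1, h2, smul_smul,
          (Fin.succ_ne_zero _).symm, hblock, one_add_one_eq_two]
    · intro a
      refine Fin.cases ?_ (fun a => ?_) a
      · ext (i | i) (j | j) <;> by_cases hij : i = j <;>
          simp [fromBlocks_conjTranspose, fromBlocks_multiply, hij]
      · ext (i | i) (j | j) <;>
          simp [fromBlocks_conjTranspose, fromBlocks_multiply, h3, h4, diagonal_apply]
    · intro a
      refine Fin.cases ?_ (fun a => ?_) a
      · ext (i | i) (j | j) <;> by_cases hij : i = j <;>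
          simp [fromBlocks_conjTranspose, fromBlocks_multiply, hij]
      · ext (i | i) (j | j) <;>
          simp [fromBlocks_conjTranspose, fromBlocks_multiply, h3, h4, diagonal_apply]
    · intro a
      refine Fin.cases ?_ (fun a => ?_) a <;> simp [hi₀]
    · rintro (i | i) <;> rw [Fin.prod_univ_succ] <;> simp [hs, hs']
    · rintro (i | i) <;> rw [Fin.prod_univ_succ] <;> simp [hs, hs']

/-! ### Weyl systems -/

/-- The phase factor `e^{ir}`. -/
noncomputable def phase (r : ℝ) : ℂ := Complex.exp (I * (r : ℂ))

theorem phase_zero : phase 0 = 1 := by simp [phase]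

theorem phase_add (r s : ℝ) : phase (r + s) = phase r * phase s := by
  simp [phase, mul_add, Complex.exp_add]

theorem norm_phase (r : ℝ) : ‖phase r‖ = 1 := by
  rw [phase, mul_comm, Complex.norm_exp_ofReal_mul_I]

theorem conj_phase (r : ℝ) : (starRingEnd ℂ) (phase r) = phase (-r) := by
  simp [phase, ← Complex.exp_conj]

@[fun_prop]
theorem continuous_phase : Continuous phase := by unfold phase; fun_prop

theorem hasDerivAt_phase : HasDerivAt phase I 0 := by
  have h := ((Complex.ofRealCLM.hasDerivAt (x := (0 : ℝ))).const_mul I).cexp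
  simpa [phase] using! h

section

variable {H : Type*} [NormedAddCommGroup H] [InnerProductSpace ℂ H] [CompleteSpace H]

theorem norm_apply_of_mem_unitary {A : H →L[ℂ] H} (hA : A ∈ unitary (H →L[ℂ] H)) (x : H) :
    ‖A x‖ = ‖x‖ :=
  ContinuousLinearMap.norm_map_of_mem_unitary hA x

omit [CompleteSpace H] in
theorem continuous_apply_apply {X : Type*} [TopologicalSpace X] {F : X → H →L[ℂ] H}
    (hF : ∀ z x, ‖F z x‖ = ‖x‖) (hc : ∀ x, Continuous fun z => F z x) {y : X → H}
    (hy : Continuous y) : Continuous fun z => F z (y z) := by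
  rw [continuous_iff_continuousAt]
  intro z₀
  have h1 : Filter.Tendsto (fun z => F z (y z - y z₀)) (nhds z₀) (nhds 0) := by
    rw [tendsto_zero_iff_norm_tendsto_zero]
    simp only [hF]
    have : Continuous fun z => ‖y z - y z₀‖ := by fun_prop
    simpa using this.tendsto z₀
  have h2 := h1.add ((hc (y z₀)).tendsto z₀)
  simpa [ContinuousAt] using h2

/-- A strongly continuous projective unitary representation `W` of the vector group `V` with cocycle
`e^{iω/2}`: the Weyl form of the canonical commutation relations. -/
structure IsWeylSystem {V : Type*} [AddCommGroup V] [Module ℝ V] [TopologicalSpace V]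
    (ω : V →ₗ[ℝ] V →ₗ[ℝ] ℝ) (W : V → H →L[ℂ] H) : Prop where
  unitary : ∀ z, W z ∈ unitary (H →L[ℂ] H)
  zero : W 0 = 1
  mul : ∀ z w, W z * W w = phase (ω z w / 2) • W (z + w)
  continuous : ∀ x, Continuous fun z => W z x

section construction

variable {d : ℕ}

/-- The one-parameter groups with indices in `S`, multiplied together; the phase
`e^{-i z_a ∑ z_j θ_{ja} / 2}` that comes with each new factor `U a (z a)` makes the cocycle
alternating. -/
theorem exists_isWeylSystem_finset {θ : Matrix (Fin d) (Fin d) ℝ} (hθ : θ.transpose = -θ)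
    {P : Fin d → H →ₗ.[ℂ] H} {U : Fin d → ℝ → H →L[ℂ] H} (hU : ∀ j, IsUnitaryGroupOf (P j) (U j))
    (hcomm : ∀ j k s t, U j s * U k t = phase (s * t * θ j k) • (U k t * U j s))
    (S : Finset (Fin d)) :
    ∃ W : (Fin d → ℝ) → H →L[ℂ] H, (∀ z, W z ∈ unitary (H →L[ℂ] H)) ∧ W 0 = 1 ∧
      (∀ z w, W z * W w = phase ((∑ j ∈ S, ∑ k ∈ S, z j * θ j k * w k) / 2) • W (z + w)) ∧
      (∀ k s z, U k s * W z = phase (s * ∑ j ∈ S, θ k j * z j) • (W z * U k s)) ∧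
      (∀ x, Continuous fun z => W z x) ∧
      ∀ j s, W (Pi.single j s) = if j ∈ S then U j s else 1 := by
  classical
  have hskew : ∀ j k, θ j k = -θ k j := fun j k => by
    have := congrFun (congrFun hθ k) j
    simpa using this
  induction S using Finset.induction_on with
  | empty => exact ⟨fun _ => 1, fun _ => one_mem _, rfl, by simp [phase_zero],
      by simp [phase_zero], fun x => continuous_const, by simp⟩
  | insert a S ha ih =>
    obtain ⟨W, hWu, hW0, hWm, hWU, hWc, hWs⟩ := ih
    have hphase : ∀ r, phase r ∈ unitary ℂ := fun r => by
      rw [Unitary.mem_iff]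
      simp [conj_phase, ← phase_add, phase_zero]
    refine ⟨fun z => phase (-(∑ j ∈ S, z j * θ j a) * z a / 2) • (W z * U a (z a)),
      fun z => ?_, ?_, ?_, ?_, ?_, ?_⟩
    · exact Unitary.smul_mem_of_mem (hphase _) (mul_mem (hWu z) ((hU a).unitary _))
    · simp [hW0, phase_zero, (hU a).zero]
    · intro z w
      have e1 : W z * U a (z a) * (W w * U a (w a)) =
          phase (z a * ∑ j ∈ S, θ a j * w j + (∑ j ∈ S, ∑ k ∈ S, z j * θ j k * w k) / 2) •
            (W (z + w) * U a (z a + w a)) := by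
        rw [mul_assoc, ← mul_assoc (U a (z a)), hWU, (hU a).add, smul_mul_assoc, mul_smul_comm,
          mul_assoc, ← mul_assoc (W z), hWm, smul_mul_assoc, smul_smul, phase_add]
      rw [smul_mul_smul_comm, e1, smul_smul, smul_smul, ← phase_add, ← phase_add, ← phase_add]
      congr 2
      have haa : θ a a = 0 := by have := hskew a a; linarith
      have hA : ∑ j ∈ S, θ a j * w j = -∑ j ∈ S, w j * θ j a := by
        rw [← Finset.sum_neg_distrib]
        exact Finset.sum_congr rfl fun j _ => by rw [hskew]; ring
      have hB : ∑ k ∈ S, z a * θ a k * w k = - (z a * ∑ j ∈ S, w j * θ j a) := by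
        rw [Finset.mul_sum, ← Finset.sum_neg_distrib]
        exact Finset.sum_congr rfl fun j _ => by rw [hskew]; ring
      have hC : ∑ j ∈ S, z j * θ j a * w a = (∑ j ∈ S, z j * θ j a) * w a := by
        rw [Finset.sum_mul]
      simp only [Finset.sum_insert ha, Finset.sum_add_distrib, haa, hA, hB, hC, Pi.add_apply,
        add_mul]
      ring
    · intro k s z
      have e1 : U k s * (W z * U a (z a)) =
          phase (s * ∑ j ∈ S, θ k j * z j + s * z a * θ k a) • ((W z * U a (z a)) * U k s) := by
        rw [← mul_assoc, hWU, smul_mul_assoc, mul_assoc, hcomm, mul_smul_comm, smul_smul,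
          ← mul_assoc, phase_add]
      rw [mul_smul_comm, e1, smul_smul, smul_mul_assoc, smul_smul, ← phase_add, ← phase_add]
      congr 2
      rw [Finset.sum_insert ha]
      ring
    · intro x
      have h1 : Continuous fun z : Fin d → ℝ => U a (z a) x :=
        ((hU a).continuous x).comp (continuous_apply a)
      have h2 := continuous_apply_apply (fun z => norm_apply_of_mem_unitary (hWu z)) hWc h1
      have h3 : Continuous fun z : Fin d → ℝ => phase (-(∑ j ∈ S, z j * θ j a) * z a / 2) := by
        fun_prop
      simpa using! h3.smul h2
    · intro j s
      by_cases hj : j = a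
      · subst hj
        have : ∑ i ∈ S, (Pi.single j s : Fin d → ℝ) i * θ i j = 0 :=
          Finset.sum_eq_zero fun i hi => by
            rw [Pi.single_eq_of_ne (ne_of_mem_of_not_mem hi ha), zero_mul]
        simp [this, phase_zero, hWs, ha]
      · simp [phase_zero, hWs, hj, (hU a).zero]

/-- The Heisenberg relations integrate to a Weyl system for the form with matrix `θ`. -/
theorem exists_isWeylSystem {θ : Matrix (Fin d) (Fin d) ℝ} (hθ : θ.transpose = -θ)
    {P : Fin d → H →ₗ.[ℂ] H} {U : Fin d → ℝ → H →L[ℂ] H} (hU : ∀ j, IsUnitaryGroupOf (P j) (U j))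
    (hcomm : ∀ j k s t, U j s * U k t = phase (s * t * θ j k) • (U k t * U j s)) :
    ∃ W : (Fin d → ℝ) → H →L[ℂ] H, IsWeylSystem (Matrix.toLinearMap₂' ℝ θ) W ∧
      ∀ j s, W (Pi.single j s) = U j s := by
  obtain ⟨W, hWu, hW0, hWm, -, hWc, hWs⟩ := exists_isWeylSystem_finset hθ hU hcomm Finset.univ
  refine ⟨W, ⟨hWu, hW0, fun z w => ?_, hWc⟩, fun j s => by simp [hWs]⟩
  rw [hWm, Matrix.toLinearMap₂'_apply]
  simp [mul_assoc, mul_comm (θ _ _)]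

end construction

namespace IsWeylSystem

variable {V : Type*} [AddCommGroup V] [Module ℝ V] [TopologicalSpace V]
  {ω : V →ₗ[ℝ] V →ₗ[ℝ] ℝ} {W : V → H →L[ℂ] H}

theorem comp (hW : IsWeylSystem ω W) {V' : Type*} [AddCommGroup V'] [Module ℝ V']
    [TopologicalSpace V'] (L : V' →ₗ[ℝ] V) (hL : Continuous L) :
    IsWeylSystem (ω.compl₁₂ L L) fun z => W (L z) where
  unitary z := hW.unitary _
  zero := by simp [hW.zero]
  mul z w := by simp [hW.mul]
  continuous x := (hW.continuous x).comp hL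

theorem norm_apply (hW : IsWeylSystem ω W) (z : V) (x : H) : ‖W z x‖ = ‖x‖ :=
  norm_apply_of_mem_unitary (hW.unitary z) x

theorem apply_apply (hW : IsWeylSystem ω W) (z w : V) (x : H) :
    W z (W w x) = phase (ω z w / 2) • W (z + w) x := by
  have := congrArg (fun A => A x) (hW.mul z w)
  simpa using this

theorem apply_neg_apply (hW : IsWeylSystem ω W) (hω : ω.IsAlt) (z : V) (x : H) :
    W z (W (-z) x) = x := by
  simp [hW.apply_apply, hW.zero, hω.self_eq_zero, phase_zero]

theorem apply_comm (hW : IsWeylSystem ω W) (hω : ω.IsAlt) (z w : V) (x : H) :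
    W z (W w x) = phase (ω z w) • W w (W z x) := by
  rw [hW.apply_apply, hW.apply_apply, smul_smul, ← phase_add, add_comm w z, ← hω.neg z w]
  congr 2
  ring

theorem inner_apply_left (hW : IsWeylSystem ω W) (hω : ω.IsAlt) (z : V) (x y : H) :
    ⟪W z x, y⟫_ℂ = ⟪x, W (-z) y⟫_ℂ := by
  conv_lhs => rw [← hW.apply_neg_apply hω z y]
  exact ContinuousLinearMap.inner_map_map_of_mem_unitary (hW.unitary z) x _

theorem continuous_apply (hW : IsWeylSystem ω W) {X : Type*} [TopologicalSpace X] {f : X → V}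
    (hf : Continuous f) {y : X → H} (hy : Continuous y) : Continuous fun t => W (f t) (y t) :=
  continuous_apply_apply (fun t => hW.norm_apply (f t)) (fun x => (hW.continuous x).comp hf) hy

end IsWeylSystem

/-! ### Generators of a Weyl system -/

/-- `HasGenerator W z x y` says that `x` lies in the domain of the self-adjoint generator `P(z)` of
the one-parameter group `t ↦ W (t z) = e^{itP(z)}`, and that `P(z) x = y`. -/
def HasGenerator {V : Type*} [AddCommGroup V] [Module ℝ V] (W : V → H →L[ℂ] H)
    (z : V) (x y : H) : Prop :=
  HasDerivAt (fun t : ℝ => W (t • z) x) (I • y) 0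

namespace IsWeylSystem

variable {V : Type*} [AddCommGroup V] [Module ℝ V] [TopologicalSpace V]
  {ω : V →ₗ[ℝ] V →ₗ[ℝ] ℝ} {W : V → H →L[ℂ] H}

omit [CompleteSpace H] [TopologicalSpace V] in
theorem _root_.Weyl.hasGenerator_zero (W : V → H →L[ℂ] H) (x : H) : HasGenerator W 0 x 0 := by
  simp only [HasGenerator, smul_zero]
  exact hasDerivAt_const _ _

omit [CompleteSpace H] [TopologicalSpace V] in
theorem _root_.Weyl.HasGenerator.smul {z : V} {x y : H} (h : HasGenerator W z x y)
    (c : ℝ) : HasGenerator W (c • z) x (c • y) := by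
  have h1 : HasDerivAt (fun t : ℝ => W (t • z) x) (I • y) (0 * c) := by simpa using! h
  have h2 := HasDerivAt.scomp (0 : ℝ) h1 ((hasDerivAt_id (0 : ℝ)).mul_const c)
  simp only [one_mul] at h2
  rw [smul_comm] at h2
  simpa [HasGenerator, Function.comp_def, smul_smul] using! h2

/-- The generators add up on the intersection of their domains. -/
theorem hasGenerator_add [ContinuousSMul ℝ V] (hW : IsWeylSystem ω W) {z w : V} {x y y' : H}
    (h : HasGenerator W z x y) (h' : HasGenerator W w x y') :
    HasGenerator W (z + w) x (y + y') := by
  have h1 : HasDerivAt (fun t : ℝ => W (t • z) (W (t • w) x)) (I • (y + y')) 0 := by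
    -- the difference quotient splits as `W (tz) (W (tw) x - x) / t + (W (tz) x - x) / t`
    rw [HasGenerator, hasDerivAt_iff_tendsto_slope] at h'
    rw [hasDerivAt_iff_tendsto_slope]
    have h2 := (hasDerivAt_iff_tendsto_slope.1 h)
    have h3 : Filter.Tendsto
        (fun t : ℝ => W (t • z) (slope (fun t : ℝ => W (t • w) x) 0 t))
        (nhdsWithin 0 {0}ᶜ) (nhds (I • y')) := by
      have hc : Filter.Tendsto (fun t : ℝ => W (t • z) (I • y')) (nhdsWithin 0 {0}ᶜ)
          (nhds (I • y')) := by
        have : Continuous fun t : ℝ => W (t • z) (I • y') :=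
          hW.continuous_apply (by fun_prop) continuous_const
        have := this.tendsto 0
        simp only [zero_smul, hW.zero, one_apply_eq_self] at this
        exact this.mono_left nhdsWithin_le_nhds
      have h0 : Filter.Tendsto
          (fun t : ℝ => W (t • z) (slope (fun t : ℝ => W (t • w) x) 0 t - I • y'))
          (nhdsWithin 0 {0}ᶜ) (nhds 0) := by
        rw [tendsto_zero_iff_norm_tendsto_zero]
        simp only [hW.norm_apply]
        rw [← tendsto_zero_iff_norm_tendsto_zero]
        simpa using h'.sub_const (I • y')
      simpa using h0.add hc
    have h4 := h2.add h3
    rw [smul_add]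
    refine h4.congr fun t => ?_
    simp [slope, hW.zero, smul_sub]
  have h5 : HasDerivAt (fun t : ℝ => phase (-(t ^ 2 * ω z w / 2))) 0 0 := by
    have h6 : HasDerivAt (fun t : ℝ => -(t ^ 2 * ω z w / 2)) 0 0 := by
      have := (((hasDerivAt_id (0 : ℝ)).pow 2).mul_const (ω z w)).div_const 2 |>.neg
      simpa using! this
    have h7 : HasDerivAt phase I (-((0 : ℝ) ^ 2 * ω z w / 2)) := by
      simpa using hasDerivAt_phase
    simpa using! HasDerivAt.scomp (0 : ℝ) h7 h6
  have h8 := h5.smul h1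
  have h9 : (fun t : ℝ => W (t • (z + w)) x) =
      fun t : ℝ => phase (-(t ^ 2 * ω z w / 2)) • W (t • z) (W (t • w) x) := by
    funext t
    rw [hW.apply_apply, smul_smul, ← phase_add, smul_add]
    have : -(t ^ 2 * ω z w / 2) + ω (t • z) (t • w) / 2 = 0 := by simp; ring
    rw [this, phase_zero, one_smul]
  rw [HasGenerator, h9]
  simpa [phase_zero] using! h8

theorem hasGenerator_sum [ContinuousSMul ℝ V] (hW : IsWeylSystem ω W) {κ : Type*} (S : Finset κ)
    {z : κ → V} {x : H} {y : κ → H} (h : ∀ k, HasGenerator W (z k) x (y k)) :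
    HasGenerator W (∑ k ∈ S, z k) x (∑ k ∈ S, y k) := by
  classical
  induction S using Finset.induction_on with
  | empty => simpa using hasGenerator_zero W x
  | insert a S ha ih =>
    rw [Finset.sum_insert ha, Finset.sum_insert ha]
    exact hW.hasGenerator_add (h a) ih

/-- The generator commutes with its own group, so `t ↦ W (t z) x` has constant speed `‖P(z) x‖`. -/
theorem norm_apply_sub_le (hW : IsWeylSystem ω W) (hω : ω.IsAlt) {z : V} {x y : H}
    (h : HasGenerator W z x y) : ‖W z x - x‖ ≤ ‖y‖ := by
  have hd : ∀ s : ℝ, HasDerivAt (fun t : ℝ => W (t • z) x) (W (s • z) (I • y)) s := by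
    intro s
    have h1 : HasDerivAt (fun t : ℝ => W (s • z) (W (t • z) x)) (W (s • z) (I • y)) (s - s) := by
      rw [sub_self]
      exact ((W (s • z)).restrictScalars ℝ).hasFDerivAt.comp_hasDerivAt (0 : ℝ) h
    have h2 := h1.comp_sub_const s s
    convert! h2 using 1
    funext t
    rw [hW.apply_apply]
    simp [hω.self_eq_zero, phase_zero, ← add_smul]
  have := norm_image_sub_le_of_norm_deriv_le_segment_01' (f := fun t : ℝ => W (t • z) x)
    (f' := fun s => W (s • z) (I • y)) (C := ‖y‖) (fun s _ => (hd s).hasDerivWithinAt)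
    (fun s _ => by rw [hW.norm_apply, norm_smul]; simp)
  simpa [hW.zero] using this

/-- The generators are symmetric. -/
theorem inner_generator_left (hW : IsWeylSystem ω W) (hω : ω.IsAlt) {z : V} {x x' y y' : H}
    (hx : HasGenerator W z x x') (hy : HasGenerator W z y y') :
    ⟪x', y⟫_ℂ = ⟪x, y'⟫_ℂ := by
  have h1 := hx.inner ℂ (hasDerivAt_const (0 : ℝ) y)
  have h2 := (hasDerivAt_const (0 : ℝ) x).inner ℂ (hy.smul (-1))
  have h3 : (fun t : ℝ => ⟪W (t • z) x, y⟫_ℂ) = fun t : ℝ => ⟪x, W (t • (-1 : ℝ) • z) y⟫_ℂ := by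
    funext t
    rw [hW.inner_apply_left hω]
    simp
  rw [h3] at h1
  have := h1.unique h2
  simpa [inner_smul_left, inner_smul_right, hW.zero] using this

/-- The Heisenberg relation `[P(z), P(w)] = -i ω(z, w)` in the sense of quadratic forms. -/
theorem inner_generator_sub (hW : IsWeylSystem ω W) (hω : ω.IsAlt) {z w : V}
    {x xz xw y yz yw : H} (hxz : HasGenerator W z x xz) (hxw : HasGenerator W w x xw)
    (hyz : HasGenerator W z y yz) (hyw : HasGenerator W w y yw) :
    ⟪xz, yw⟫_ℂ - ⟪xw, yz⟫_ℂ = -(I * ω z w * ⟪x, y⟫_ℂ) := by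
  -- differentiate `⟪W(-sz) x, W(tw) y⟫ = e^{ist ω(z,w)} ⟪W(-tw) x, W(sz) y⟫` in `s`, then in `t`
  have hneg : ∀ {z : V} {x y : H}, HasGenerator W z x y → HasGenerator W (-z) x (-y) := by
    intro z x y h
    simpa using h.smul (-1)
  have hW0 : ∀ x, W 0 x = x := by simp [hW.zero]
  have key : ∀ s t : ℝ, ⟪W (s • -z) x, W (t • w) y⟫_ℂ =
      phase (s * (t * ω z w)) * ⟪W (t • -w) x, W (s • z) y⟫_ℂ := by
    intro s t
    rw [hW.inner_apply_left hω, hW.inner_apply_left hω, smul_neg, smul_neg, neg_neg, neg_neg,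
      hW.apply_comm hω, inner_smul_right]
    simp [mul_left_comm]
  have hs : ∀ t : ℝ, I * ⟪xz, W (t • w) y⟫_ℂ =
      (t * ω z w : ℝ) * I * ⟪W (t • -w) x, y⟫_ℂ + I * ⟪W (t • -w) x, yz⟫_ℂ := by
    intro t
    have h1 := (hneg hxz).inner ℂ (hasDerivAt_const (0 : ℝ) (W (t • w) y))
    have h2 := (hasDerivAt_const (0 : ℝ) (W (t • -w) x)).inner ℂ hyz
    have h3 : HasDerivAt (fun s : ℝ => phase (s * (t * ω z w))) ((t * ω z w : ℝ) * I) 0 := by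
      have h4 : HasDerivAt phase I (0 * (t * ω z w)) := by simpa using hasDerivAt_phase
      simpa using! HasDerivAt.scomp (0 : ℝ) h4 ((hasDerivAt_id (0 : ℝ)).mul_const (t * ω z w))
    have h5 := h3.mul h2
    have h6 := h1.unique (h5.congr_of_eventuallyEq (Filter.Eventually.of_forall fun s => key s t))
    simpa [inner_smul_left, inner_smul_right, hW0, phase_zero] using h6
  have h1 := ((hasDerivAt_const (0 : ℝ) xz).inner ℂ hyw).const_mul I
  have h2 := (hneg hxw).inner ℂ (hasDerivAt_const (0 : ℝ) y)
  have h3 := ((hneg hxw).inner ℂ (hasDerivAt_const (0 : ℝ) yz)).const_mul I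
  have h4 : HasDerivAt (fun t : ℝ => ((t * ω z w : ℝ) : ℂ) * I) (ω z w * I) 0 := by
    have := ((hasDerivAt_id (0 : ℝ)).mul_const (ω z w)).ofReal_comp.mul_const I
    simpa using! this
  have h5 := h1.unique (((h4.mul h2).add h3).congr_of_eventuallyEq
    (Filter.Eventually.of_forall hs))
  simp only [inner_smul_left, inner_smul_right, hW0, inner_zero_left, inner_zero_right, zero_smul,
    add_zero, zero_add, neg_zero,
    inner_neg_left, smul_neg, Complex.conj_I, zero_mul, Complex.ofReal_zero] at h5
  ring_nf at h5
  simp only [Complex.I_sq] at h5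
  linear_combination -h5

end IsWeylSystem

end

/-! ### The Dirac operator -/

section Dirac

variable {H : Type*} [NormedAddCommGroup H] [InnerProductSpace ℂ H]
  {D : Submodule ℂ H} {κ ι : Type*} [Fintype κ] [DecidableEq κ] [Fintype ι] [DecidableEq ι]

/-- The (half) Dirac operator `∑ α, C α ⊗ p α` of a tuple of operators `p` with common domain `D`,
acting on columns of vectors. -/
noncomputable def diracMap (C : κ → Matrix ι ι ℂ) (p : κ → D →ₗ[ℂ] H) :
    (ι → D) →ₗ[ℂ] PiLp 2 fun _ : ι => H where
  toFun ψ := WithLp.toLp 2 fun i => ∑ α, ∑ j, C α i j • p α (ψ j)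
  map_add' ψ φ := by
    ext i
    simp [Finset.sum_add_distrib]
  map_smul' c ψ := by
    ext i
    simp [Finset.smul_sum, smul_comm c]

omit [DecidableEq κ] [DecidableEq ι] in
theorem diracMap_apply (C : κ → Matrix ι ι ℂ) (p : κ → D →ₗ[ℂ] H) (ψ : ι → D) (i : ι) :
    diracMap C p ψ i = ∑ α, ∑ j, C α i j • p α (ψ j) := rfl

omit [DecidableEq κ] [DecidableEq ι] in
theorem inner_diracMap_self (C : κ → Matrix ι ι ℂ) (p : κ → D →ₗ[ℂ] H) (ψ : ι → D) :
    ⟪diracMap C p ψ, diracMap C p ψ⟫_ℂ =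
      ∑ α, ∑ β, ∑ i, ∑ j, ((C α)ᴴ * C β) i j * ⟪p α (ψ i), p β (ψ j)⟫_ℂ := by
  simp only [PiLp.inner_apply, diracMap_apply, sum_inner, inner_sum, inner_smul_left,
    inner_smul_right, Matrix.mul_apply, Matrix.conjTranspose_apply, Finset.sum_mul]
  rw [Finset.sum_comm]
  conv_rhs => rw [Finset.sum_comm]
  refine Finset.sum_congr rfl fun β _ => ?_
  simp only [Finset.mul_sum]
  calc _ = ∑ k, ∑ α, ∑ i, ∑ j, star (C α k i) * C β k j * ⟪p α (ψ i), p β (ψ j)⟫_ℂ := by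
        refine Finset.sum_congr rfl fun k _ => ?_
        rw [Finset.sum_comm]
        refine Finset.sum_congr rfl fun α _ => ?_
        rw [Finset.sum_comm]
        refine Finset.sum_congr rfl fun i _ => Finset.sum_congr rfl fun j _ => ?_
        simp only [RCLike.star_def]
        ring
    _ = _ := by
        rw [Finset.sum_comm]
        refine Finset.sum_congr rfl fun α _ => ?_
        rw [Finset.sum_comm]
        refine Finset.sum_congr rfl fun i _ => ?_
        rw [Finset.sum_comm]

/-- The Weitzenböck formula: the Clifford relations turn the off-diagonal terms of `‖diracMap C p
ψ‖²` into commutators. -/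
theorem two_mul_inner_diracMap_self {C : κ → Matrix ι ι ℂ} {p : κ → D →ₗ[ℂ] H}
    {σ : κ → κ → ℝ} (hC : ∀ α β, (C α)ᴴ * C β + (C β)ᴴ * C α = if α = β then 2 else 0)
    (hp : ∀ α β x y, ⟪p α x, p β y⟫_ℂ - ⟪p β x, p α y⟫_ℂ = -(I * σ α β * ⟪(x : H), y⟫_ℂ))
    (ψ : ι → D) :
    2 * ⟪diracMap C p ψ, diracMap C p ψ⟫_ℂ =
      2 * ∑ α, ∑ i, ⟪p α (ψ i), p α (ψ i)⟫_ℂ +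
      ∑ α, ∑ β, ∑ i, ∑ j, I * σ α β * (((C β)ᴴ * C α) i j * ⟪(ψ i : H), ψ j⟫_ℂ) := by
  rw [inner_diracMap_self, two_mul]
  have h1 : ∑ α, ∑ β, ∑ i, ∑ j, ((C α)ᴴ * C β) i j * ⟪p α (ψ i), p β (ψ j)⟫_ℂ =
      ∑ α, ∑ β, ∑ i, ∑ j, (((C β)ᴴ * C α) i j * ⟪p α (ψ i), p β (ψ j)⟫_ℂ +
        I * σ α β * (((C β)ᴴ * C α) i j * ⟪(ψ i : H), ψ j⟫_ℂ)) := by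
    rw [Finset.sum_comm]
    refine Finset.sum_congr rfl fun α _ => Finset.sum_congr rfl fun β _ =>
      Finset.sum_congr rfl fun i _ => Finset.sum_congr rfl fun j _ => ?_
    linear_combination (-((C β)ᴴ * C α) i j) * hp α β (ψ i) (ψ j)
  conv_lhs => enter [2]; rw [h1]
  simp only [Finset.sum_add_distrib]
  rw [← add_assoc]
  congr 1
  simp only [← Finset.sum_add_distrib, ← add_mul, ← Matrix.add_apply, hC]
  rw [Finset.mul_sum]
  refine Finset.sum_congr rfl fun α _ => ?_
  rw [Finset.sum_eq_single α (by intro β _ h; simp [h.symm]) (by simp), Finset.mul_sum]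
  refine Finset.sum_congr rfl fun i _ => ?_
  rw [Finset.sum_eq_single i]
  · simp [Matrix.ofNat_apply]
  · intro j _ h
    simp [Matrix.ofNat_apply, h.symm]
  · simp

/-- For commuting operators the cross terms cancel. -/
theorem norm_sq_diracMap {C : κ → Matrix ι ι ℂ} {p : κ → D →ₗ[ℂ] H}
    (hC : ∀ α β, (C α)ᴴ * C β + (C β)ᴴ * C α = if α = β then 2 else 0)
    (hp : ∀ α β x y, ⟪p α x, p β y⟫_ℂ = ⟪p β x, p α y⟫_ℂ) (ψ : ι → D) :
    ‖diracMap C p ψ‖ ^ 2 = ∑ α, ∑ i, ‖p α (ψ i)‖ ^ 2 := by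
  have h := two_mul_inner_diracMap_self (p := p) (σ := fun _ _ => 0) hC
    (fun α β x y => by simp [hp α β x y]) ψ
  simp only [inner_self_eq_norm_sq_to_K, Complex.coe_algebraMap] at h
  simp only [Complex.ofReal_zero, mul_zero, zero_mul, Finset.sum_const_zero, add_zero] at h
  exact_mod_cast mul_left_cancel₀ two_ne_zero h

end Dirac

section spinor

variable {H : Type*} [NormedAddCommGroup H] [InnerProductSpace ℂ H]
  {D : Submodule ℂ H} {κ ι : Type*} [Fintype κ] [DecidableEq κ] [Fintype ι] [DecidableEq ι]
  {C : κ ⊕ κ → Matrix ι ι ℂ} {s s' : κ → ι → ℤˣ} {p : κ ⊕ κ → D →ₗ[ℂ] H}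

omit [Fintype κ] in
/-- The zero-point energy of the harmonic oscillator `p² + q²`. -/
theorem norm_sq_le_of_canonical_pair
    (hp : ∀ α β x y, ⟪p α x, p β y⟫_ℂ - ⟪p β x, p α y⟫_ℂ =
      -(I * (Matrix.J κ ℝ α β : ℝ) * ⟪(x : H), y⟫_ℂ)) (a : κ) (x : D) :
    ‖(x : H)‖ ^ 2 ≤ ‖p (.inl a) x‖ ^ 2 + ‖p (.inr a) x‖ ^ 2 := by
  have h := congrArg Complex.im (hp (.inl a) (.inr a) x x)
  simp only [Matrix.J, Matrix.fromBlocks_apply₁₂, Matrix.neg_apply, Matrix.one_apply_eq,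
    inner_self_eq_norm_sq_to_K, Complex.coe_algebraMap] at h
  have h4 : (⟪p (.inr a) x, p (.inl a) x⟫_ℂ).im = -(⟪p (.inl a) x, p (.inr a) x⟫_ℂ).im :=
    inner_im_symm (𝕜 := ℂ) _ _
  have h5 : ((‖(x : H)‖ : ℂ) ^ 2).re = ‖(x : H)‖ ^ 2 := by
    rw [← Complex.ofReal_pow, Complex.ofReal_re]
  simp [h4, h5] at h
  have h1 := Complex.abs_im_le_norm ⟪p (.inl a) x, p (.inr a) x⟫_ℂ
  have h2 := norm_inner_le_norm (𝕜 := ℂ) (p (.inl a) x) (p (.inr a) x)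
  have h3 := le_abs_self (⟪p (.inl a) x, p (.inr a) x⟫_ℂ).im
  nlinarith [sq_nonneg (‖p (.inl a) x‖ - ‖p (.inr a) x‖)]

/-- For canonical pairs, `‖diracMap C p ψ‖²` is the sum over the components and the modes of the
quadratic forms of the shifted harmonic oscillators `p² + q² ∓ 1`. -/
theorem IsCliffordFamily.norm_sq_diracMap (hC : IsCliffordFamily C s s')
    (hp : ∀ α β x y, ⟪p α x, p β y⟫_ℂ - ⟪p β x, p α y⟫_ℂ =
      -(I * (Matrix.J κ ℝ α β : ℝ) * ⟪(x : H), y⟫_ℂ)) (ψ : ι → D) :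
    ‖diracMap C p ψ‖ ^ 2 = ∑ i, ∑ a, (‖p (.inl a) (ψ i)‖ ^ 2 + ‖p (.inr a) (ψ i)‖ ^ 2 -
      ((s' a i : ℤ) : ℝ) * ‖(ψ i : H)‖ ^ 2) := by
  have h := two_mul_inner_diracMap_self hC.conjTranspose_mul hp ψ
  have hs : ∀ a, (C (.inr a))ᴴ * C (.inl a) =
      -(I • Matrix.diagonal fun i => (((s' a i : ℤˣ) : ℤ) : ℂ)) := by
    intro a
    rw [← hC.sign' a, eq_neg_iff_add_eq_zero, hC.conjTranspose_mul]
    simp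
  have h2 : ∑ α, ∑ β, ∑ i, ∑ j, I * (Matrix.J κ ℝ α β : ℝ) *
      (((C β)ᴴ * C α) i j * ⟪(ψ i : H), ψ j⟫_ℂ) =
      -2 * ∑ i, ∑ a, ((s' a i : ℤ) : ℂ) * ⟪(ψ i : H), ψ i⟫_ℂ := by
    have h3 : ∀ a b, (Matrix.J κ ℝ (.inl a) (.inr b) : ℝ) = if a = b then -1 else 0 := by
      intro a b
      simp [Matrix.J, Matrix.one_apply, neg_ite]
    have h4 : ∀ a b, (Matrix.J κ ℝ (.inr a) (.inl b) : ℝ) = if a = b then 1 else 0 := by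
      intro a b
      simp [Matrix.J, Matrix.one_apply]
    have h5 : ∀ a b, (Matrix.J κ ℝ (.inl a) (.inl b) : ℝ) = 0 := fun a b => by simp [Matrix.J]
    have h6 : ∀ a b, (Matrix.J κ ℝ (.inr a) (.inr b) : ℝ) = 0 := fun a b => by simp [Matrix.J]
    simp only [Fintype.sum_sum_type, h5, h6, Complex.ofReal_zero, mul_zero, zero_mul,
      Finset.sum_const_zero, zero_add, add_zero]
    have h7 : ∀ a, ∑ b, ∑ i, ∑ j, I * (Matrix.J κ ℝ (.inl a) (.inr b) : ℝ) *
        (((C (.inr b))ᴴ * C (.inl a)) i j * ⟪(ψ i : H), ψ j⟫_ℂ) =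
        -∑ i, ((s' a i : ℤ) : ℂ) * ⟪(ψ i : H), ψ i⟫_ℂ := by
      intro a
      rw [Finset.sum_eq_single a (by intro b _ hb; simp [h3, hb.symm]) (by simp),
        ← Finset.sum_neg_distrib]
      refine Finset.sum_congr rfl fun i _ => ?_
      rw [Finset.sum_eq_single i (by intro j _ hj; simp [hs, hj.symm]) (by simp), h3, hs]
      simp
      linear_combination (((s' a i : ℤ) : ℂ) * (‖(ψ i : H)‖ : ℂ) ^ 2) * Complex.I_mul_I
    have h8 : ∀ a, ∑ b, ∑ i, ∑ j, I * (Matrix.J κ ℝ (.inr a) (.inl b) : ℝ) *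
        (((C (.inl b))ᴴ * C (.inr a)) i j * ⟪(ψ i : H), ψ j⟫_ℂ) =
        -∑ i, ((s' a i : ℤ) : ℂ) * ⟪(ψ i : H), ψ i⟫_ℂ := by
      intro a
      rw [Finset.sum_eq_single a (by intro b _ hb; simp [h4, hb.symm]) (by simp),
        ← Finset.sum_neg_distrib]
      refine Finset.sum_congr rfl fun i _ => ?_
      rw [Finset.sum_eq_single i (by intro j _ hj; simp [hC.sign', hj.symm]) (by simp), h4,
        hC.sign']
      simp
      linear_combination (((s' a i : ℤ) : ℂ) * (‖(ψ i : H)‖ : ℂ) ^ 2) * Complex.I_mul_I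
    simp only [h7, h8, Finset.sum_neg_distrib]
    rw [Finset.sum_comm]
    ring
  rw [h2] at h
  simp only [inner_self_eq_norm_sq_to_K, Complex.coe_algebraMap] at h
  have h9 : ((‖diracMap C p ψ‖ : ℂ)) ^ 2 = ∑ α, ∑ i, (‖p α (ψ i)‖ : ℂ) ^ 2 -
      ∑ i, ∑ a, ((s' a i : ℤ) : ℂ) * (‖(ψ i : H)‖ : ℂ) ^ 2 := by
    linear_combination h / 2
  have h10 : ‖diracMap C p ψ‖ ^ 2 = ∑ α, ∑ i, ‖p α (ψ i)‖ ^ 2 -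
      ∑ i, ∑ a, ((s' a i : ℤ) : ℝ) * ‖(ψ i : H)‖ ^ 2 := by exact_mod_cast h9
  rw [h10, Finset.sum_comm, ← Finset.sum_sub_distrib]
  refine Finset.sum_congr rfl fun i _ => ?_
  rw [Fintype.sum_sum_type, ← Finset.sum_add_distrib, ← Finset.sum_sub_distrib]

/-- Every spinor component has a mode of sign `-1`, where the shifted oscillator `p² + q² + 1` is
strictly positive, so there are no zero modes. -/
theorem IsCliffordFamily.eq_zero_of_diracMap_eq_zero (hC : IsCliffordFamily C s s')
    (hs' : ∀ i, ∃ a, s' a i = -1)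
    (hp : ∀ α β x y, ⟪p α x, p β y⟫_ℂ - ⟪p β x, p α y⟫_ℂ =
      -(I * (Matrix.J κ ℝ α β : ℝ) * ⟪(x : H), y⟫_ℂ)) {ψ : ι → D} (hψ : diracMap C p ψ = 0) :
    ψ = 0 := by
  have h := hC.norm_sq_diracMap hp ψ
  rw [hψ, norm_zero, zero_pow two_ne_zero] at h
  have hnn : ∀ i a, 0 ≤ ‖p (.inl a) (ψ i)‖ ^ 2 + ‖p (.inr a) (ψ i)‖ ^ 2 -
      ((s' a i : ℤ) : ℝ) * ‖(ψ i : H)‖ ^ 2 := by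
    intro i a
    have h1 := norm_sq_le_of_canonical_pair hp a (ψ i)
    rcases Int.units_eq_one_or (s' a i) with h2 | h2
    · simp only [h2, Units.val_one, Int.cast_one, one_mul]
      linarith
    · simp only [h2, Units.val_neg, Units.val_one, Int.cast_neg, Int.cast_one]
      nlinarith [sq_nonneg ‖(ψ i : H)‖]
  funext i
  obtain ⟨a, ha⟩ := hs' i
  have h1 := (Finset.sum_eq_zero_iff_of_nonneg
    (fun i _ => Finset.sum_nonneg fun a _ => hnn i a)).1 h.symm i (Finset.mem_univ _)
  have h2 := (Finset.sum_eq_zero_iff_of_nonneg (fun a _ => hnn i a)).1 h1 a (Finset.mem_univ _)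
  have h3 := norm_sq_le_of_canonical_pair hp a (ψ i)
  simp only [ha, Units.val_neg, Units.val_one, Int.cast_neg, Int.cast_one] at h2
  have h4 : ‖(ψ i : H)‖ ^ 2 = 0 := by nlinarith [sq_nonneg ‖(ψ i : H)‖]
  simpa using h4

/-- The joint vacuum `Ω` in a component with all signs `1` is orthogonal to the range of the Dirac
operator: in that row of `C` the two matrices of each pair combine with `p (inl a)` and `p (inr a)`
to the creation operator, the adjoint of the annihilation operator that kills `Ω`. -/
theorem IsCliffordFamily.inner_vacuum_diracMap (hC : IsCliffordFamily C s s') {i₀ : ι}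
    (hi₀ : ∀ a, s a i₀ = 1) {Ω : H}
    (hΩ : ∀ a x, ⟪Ω, p (.inl a) x⟫_ℂ = I * ⟪Ω, p (.inr a) x⟫_ℂ) (ψ : ι → D) :
    ⟪Ω, diracMap C p ψ i₀⟫_ℂ = 0 := by
  have hu : ∀ a, (C (.inl a))ᴴ * C (.inl a) = 1 := by
    intro a
    have h := hC.conjTranspose_mul (.inl a) (.inl a)
    rw [if_pos rfl, ← two_smul ℂ] at h
    have h2 : (2 : Matrix ι ι ℂ) = (2 : ℂ) • 1 := by
      ext i j
      simp [Matrix.one_apply, Matrix.ofNat_apply]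
    rw [h2] at h
    exact smul_right_injective _ (two_ne_zero (α := ℂ)) h
  have hrow : ∀ a j, C (.inr a) i₀ j = -(I * C (.inl a) i₀ j) := by
    intro a j
    have h := congrArg (fun A => (A * C (.inl a)) ) (congrArg Matrix.conjTranspose (hC.sign a))
    simp only [Matrix.conjTranspose_mul, Matrix.conjTranspose_conjTranspose, mul_assoc, hu,
      mul_one] at h
    rw [h]
    simp [hi₀]
  rw [diracMap_apply, Fintype.sum_sum_type, ← Finset.sum_add_distrib, inner_sum]
  refine Finset.sum_eq_zero fun a _ => ?_
  rw [← Finset.sum_add_distrib, inner_sum]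
  refine Finset.sum_eq_zero fun j _ => ?_
  rw [inner_add_right, inner_smul_right, inner_smul_right, hΩ, hrow]
  ring

end spinor

/-! ### Smearing a Weyl system -/

/-- The integrated form `∫ f(z) W(z) x dz` of a Weyl system. -/
noncomputable def smear {V H : Type*} [MeasureSpace V] [NormedAddCommGroup H]
    [InnerProductSpace ℂ H] (W : V → H →L[ℂ] H) (f : V → ℂ) (x : H) : H :=
  ∫ z, f z • W z x

namespace IsWeylSystem

section smear

variable {H : Type*} [NormedAddCommGroup H] [InnerProductSpace ℂ H] [CompleteSpace H]
  {V : Type*} [NormedAddCommGroup V] [NormedSpace ℝ V] [FiniteDimensional ℝ V]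
  [MeasureSpace V] [BorelSpace V]
  {ω : V →ₗ[ℝ] V →ₗ[ℝ] ℝ} {W : V → H →L[ℂ] H} {f : V → ℂ}

theorem integrable_smul_apply (hW : IsWeylSystem ω W) (hf : Integrable f) (x : H) :
    Integrable fun z => f z • W z x := by
  have := FiniteDimensional.proper_real V
  refine (hf.norm.mul_const ‖x‖).mono'
    (hf.aestronglyMeasurable.smul (hW.continuous x).aestronglyMeasurable)
    (Filter.Eventually.of_forall fun z => ?_)
  rw [norm_smul, hW.norm_apply]

theorem map_smear (hW : IsWeylSystem ω W) (hf : Integrable f) (A : H →L[ℂ] H) (x : H) :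
    A (smear W f x) = ∫ z, f z • A (W z x) := by
  rw [smear, ← A.integral_comp_comm (hW.integrable_smul_apply hf x)]
  simp

theorem smear_add (hW : IsWeylSystem ω W) (hf : Integrable f) (x y : H) :
    smear W f (x + y) = smear W f x + smear W f y := by
  simp only [smear, map_add, smul_add]
  exact integral_add (hW.integrable_smul_apply hf x) (hW.integrable_smul_apply hf y)

omit [CompleteSpace H] [FiniteDimensional ℝ V] [BorelSpace V] [NormedSpace ℝ V]
  [NormedAddCommGroup V] in
theorem _root_.Weyl.smear_smul (c : ℂ) (x : H) : smear W f (c • x) = c • smear W f x := by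
  simp only [smear, map_smul, smul_comm _ c, integral_smul]

theorem inner_smear_left [(volume : Measure V).IsNegInvariant] (hW : IsWeylSystem ω W)
    (hω : ω.IsAlt)
    (hf : Integrable f) (heven : ∀ z, (starRingEnd ℂ) (f (-z)) = f z) (x y : H) :
    ⟪smear W f x, y⟫_ℂ = ⟪x, smear W f y⟫_ℂ := by
  have h1 : ⟪smear W f x, y⟫_ℂ = ∫ z, (starRingEnd ℂ) (f z) * ⟪x, W (-z) y⟫_ℂ := by
    rw [smear, ← inner_conj_symm, ← integral_inner (hW.integrable_smul_apply hf x),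
      ← integral_conj]
    congr 1
    funext z
    rw [inner_conj_symm, inner_smul_left, hW.inner_apply_left hω]
  rw [h1, smear, ← integral_inner (hW.integrable_smul_apply hf y), ← integral_neg_eq_self]
  congr 1
  funext z
  rw [inner_smul_right, neg_neg, heven]

end smear

end IsWeylSystem

/-! ### Gaussians -/

section Gaussian

variable {V : Type*} [NormedAddCommGroup V] [InnerProductSpace ℝ V] [FiniteDimensional ℝ V]
  [MeasurableSpace V] [BorelSpace V]

/-- The unnormalized Gaussian `e^{-b‖z‖²}`. -/
noncomputable def gaussian (b : ℝ) (z : V) : ℂ := Complex.exp (-(b : ℂ) * ‖z‖ ^ 2)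

omit [InnerProductSpace ℝ V] [FiniteDimensional ℝ V] [MeasurableSpace V] [BorelSpace V] in
theorem gaussian_eq_ofReal (b : ℝ) (z : V) :
    gaussian b z = ((Real.exp (-b * ‖z‖ ^ 2) : ℝ) : ℂ) := by
  simp [gaussian]

omit [InnerProductSpace ℝ V] [FiniteDimensional ℝ V] [MeasurableSpace V] [BorelSpace V] in
theorem norm_gaussian (b : ℝ) (z : V) : ‖gaussian b z‖ = Real.exp (-b * ‖z‖ ^ 2) := by
  rw [gaussian_eq_ofReal, Complex.norm_real, Real.norm_eq_abs, Real.abs_exp]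

omit [InnerProductSpace ℝ V] [FiniteDimensional ℝ V] [MeasurableSpace V] [BorelSpace V] in
theorem continuous_gaussian (b : ℝ) : Continuous (gaussian b : V → ℂ) := by
  unfold gaussian
  fun_prop

omit [InnerProductSpace ℝ V] [FiniteDimensional ℝ V] [MeasurableSpace V] [BorelSpace V] in
theorem conj_gaussian_neg (b : ℝ) (z : V) :
    (starRingEnd ℂ) (gaussian b (-z)) = gaussian b z := by
  rw [gaussian_eq_ofReal, gaussian_eq_ofReal, Complex.conj_ofReal, norm_neg]

theorem integrable_gaussian {b : ℝ} (hb : 0 < b) : Integrable (gaussian b : V → ℂ) := by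
  have h := GaussianFourier.integrable_cexp_neg_mul_sq_norm_add (V := V) (b := b)
    (by simpa using hb) 0 0
  convert! h using 2
  simp [gaussian]

theorem integrable_exp_neg_mul_sq {b : ℝ} (hb : 0 < b) :
    Integrable fun z : V => Real.exp (-b * ‖z‖ ^ 2) := by
  simpa only [norm_gaussian] using (integrable_gaussian (V := V) hb).norm

variable (V) in
/-- The total mass `(π / b) ^ (dim V / 2)` of the Gaussian. -/
noncomputable def gaussianMass (b : ℝ) : ℝ := (Real.pi / b) ^ (Module.finrank ℝ V / 2 : ℝ)

omit [FiniteDimensional ℝ V] [MeasurableSpace V] [BorelSpace V] in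
theorem gaussianMass_pos {b : ℝ} (hb : 0 < b) : 0 < gaussianMass V b :=
  Real.rpow_pos_of_pos (div_pos Real.pi_pos hb) _

theorem integral_exp_neg_mul_sq {b : ℝ} (hb : 0 < b) :
    ∫ z : V, Real.exp (-b * ‖z‖ ^ 2) = gaussianMass V b :=
  GaussianFourier.integral_rexp_neg_mul_sq_norm hb

/-- The Fourier transform of a Gaussian. -/
theorem integral_gaussian_mul_phase {b : ℝ} (hb : 0 < b) (r : ℝ) (w : V) :
    ∫ z : V, gaussian b z * phase (r * ⟪w, z⟫_ℝ) =
      gaussianMass V b * Complex.exp (-(r ^ 2 * ‖w‖ ^ 2 / (4 * b))) := by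
  have h := GaussianFourier.integral_cexp_neg_mul_sq_norm_add (V := V) (b := b)
    (by simpa using hb) (I * r) w
  have h2 : (gaussianMass V b : ℂ) = (Real.pi / b : ℂ) ^ (Module.finrank ℝ V / 2 : ℂ) := by
    rw [gaussianMass, Complex.ofReal_cpow (div_pos Real.pi_pos hb).le]
    push_cast
    rfl
  rw [h2]
  convert! h using 2
  · funext z
    rw [gaussian, phase, ← Complex.exp_add]
    push_cast
    ring_nf
  · rw [mul_pow, Complex.I_sq]
    ring_nf

end Gaussian

/-! ### The vacuum projection -/

namespace IsWeylSystem

variable {H : Type*} [NormedAddCommGroup H] [InnerProductSpace ℂ H] [CompleteSpace H]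
  {V : Type*} [NormedAddCommGroup V] [InnerProductSpace ℝ V] [FiniteDimensional ℝ V]
  [MeasurableSpace V] [BorelSpace V]
  {ω : V →ₗ[ℝ] V →ₗ[ℝ] ℝ} {W : V → H →L[ℂ] H} {J : V →ₗ[ℝ] V}

omit [FiniteDimensional ℝ V] [MeasurableSpace V] [BorelSpace V] in
/-- A complex structure compatible with the symplectic form and the inner product is isometric. -/
theorem _root_.Weyl.norm_complexStructure (hω : ω.IsAlt) (hJ : ∀ z w, ω z w = ⟪J z, w⟫_ℝ)
    (hJJ : ∀ z, J (J z) = -z) (z : V) : ‖J z‖ = ‖z‖ := by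
  have h : ⟪J z, J z⟫_ℝ = ⟪z, z⟫_ℝ := by
    rw [← hJ, ← hω.neg, hJ, hJJ, inner_neg_left, neg_neg]
  rw [real_inner_self_eq_norm_sq, real_inner_self_eq_norm_sq] at h
  exact (pow_left_inj₀ (norm_nonneg _) (norm_nonneg _) two_ne_zero).1 h

/-- The twisted convolution square of the vacuum Gaussian: up to normalization, the smeared operator
`p = ∫ e^{-‖z‖²/4} W(z) dz` satisfies `p W(u) p = e^{-‖u‖²/4} p`, so that it is the
projection onto the vacuum vectors. -/
theorem smear_gaussian_apply_smear_gaussian (hW : IsWeylSystem ω W) (hω : ω.IsAlt)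
    (hJ : ∀ z w, ω z w = ⟪J z, w⟫_ℝ) (hJJ : ∀ z, J (J z) = -z) (u : V) (x : H) :
    smear W (gaussian (1 / 4)) (W u (smear W (gaussian (1 / 4)) x)) =
      (gaussianMass V (1 / 2) * Real.exp (-‖u‖ ^ 2 / 4) : ℝ) • smear W (gaussian (1 / 4)) x := by
  set f : V → ℂ := gaussian (1 / 4) with hf
  have hfi : Integrable f := integrable_gaussian (by norm_num)
  have hfc : Continuous f := continuous_gaussian _
  have hωc : Continuous fun q : V × V => ω q.1 q.2 := by
    have hJc : Continuous J := J.continuous_of_finiteDimensional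
    simp only [hJ]
    fun_prop
  have h1 : smear W f (W u (smear W f x)) = ∫ z, ∫ v,
      (f z * f (v - (u + z)) * phase ((ω u v + ω z (u + v)) / 2)) • W v x := by
    rw [hW.map_smear hfi, smear]
    congr 1
    funext z
    rw [← integral_sub_right_eq_self _ (u + z), ← ContinuousLinearMap.integral_comp_comm,
      ← integral_smul]
    · congr 1
      funext v
      simp only [map_smul, hW.apply_apply, smul_smul, ← phase_add, mul_assoc]
      congr 4
      · simp only [map_sub, map_add, hω.self_eq_zero, ← hω.neg z u]
        ring
      · abel_nf
    · have := (hW.integrable_smul_apply hfi x)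
      have h2 := (((W u).integrable_comp this)).comp_sub_right (u + z)
      simpa using! h2
  have h2 : Integrable (Function.uncurry fun z v : V =>
      (f z * f (v - (u + z)) * phase ((ω u v + ω z (u + v)) / 2)) • W v x)
      (volume.prod volume) := by
    have h3 : Integrable (fun q : V × V => f q.1 * f (q.2 - (u + q.1))) (volume.prod volume) := by
      have h4 := (hfi.convolution_integrand (ContinuousLinearMap.mul ℂ ℂ)
        (hfi.comp_sub_right u)).swap
      convert! h4 using 1
      funext q
      simp [sub_sub, add_comm]
    refine (h3.norm.mul_const ‖x‖).mono' (Continuous.aestronglyMeasurable ?_)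
      (Filter.Eventually.of_forall fun q => ?_)
    · have h5 : Continuous fun q : V × V => W q.2 x := (hW.continuous x).comp continuous_snd
      have h6 : Continuous fun q : V × V => ω u q.2 :=
        hωc.comp (continuous_const.prodMk continuous_snd)
      have h7 : Continuous fun q : V × V => ω q.1 (u + q.2) :=
        hωc.comp (continuous_fst.prodMk (continuous_const.add continuous_snd))
      have h8 : Continuous fun q : V × V => q.2 - (u + q.1) := by fun_prop
      exact (((hfc.comp continuous_fst).mul (hfc.comp h8)).mul
        (continuous_phase.comp ((h6.add h7).div_const 2))).smul h5
    · simp [Function.uncurry, norm_smul, norm_phase, hW.norm_apply]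
  rw [h1, integral_integral_swap h2, smear, ← integral_smul]
  congr 1
  funext v
  rw [integral_smul_const, ← smul_assoc]
  congr 1
  -- complete the square: the shift by `(v - u) / 2` centres the Gaussian in `z`
  set a : V := (1 / 2 : ℝ) • (v - u) with ha
  rw [← integral_add_right_eq_self _ a]
  have h8 : ∀ z : V, f (z + a) * f (v - (u + (z + a))) *
      phase ((ω u v + ω (z + a) (u + v)) / 2) =
      Complex.exp (-(‖a‖ ^ 2 / 2)) *
        (gaussian (1 / 2) z * phase (-(1 / 2) * ⟪J (u + v), z⟫_ℝ)) := by
    intro z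
    have e1 : v - (u + (z + a)) = a - z := by
      have : v - u = (2 : ℝ) • a := by rw [ha, smul_smul]; norm_num
      rw [← sub_sub, this, two_smul]
      abel
    have e2 : ω u v + ω (z + a) (u + v) = -⟪J (u + v), z⟫_ℝ := by
      rw [← hJ, hω.neg]
      simp only [ha, map_add, map_smul, map_sub, LinearMap.add_apply, LinearMap.smul_apply,
        LinearMap.sub_apply, hω.self_eq_zero, ← hω.neg u v, smul_eq_mul]
      ring
    have e3 : ‖z + a‖ ^ 2 + ‖a - z‖ ^ 2 = 2 * (‖z‖ ^ 2 + ‖a‖ ^ 2) := by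
      have := parallelogram_law_with_norm ℝ z a
      rw [norm_sub_rev z a] at this
      nlinarith [this]
    rw [e1, e2, hf]
    simp only [gaussian_eq_ofReal]
    have e4 : Complex.exp (-(‖a‖ ^ 2 / 2)) = ((Real.exp (-(‖a‖ ^ 2 / 2)) : ℝ) : ℂ) := by
      push_cast
      rfl
    rw [e4, ← mul_assoc, ← Complex.ofReal_mul, ← Complex.ofReal_mul, ← Real.exp_add,
      ← Real.exp_add]
    congr 3
    · linear_combination (-1 / 4) * e3
    · ring
  simp only [h8]
  rw [integral_const_mul, integral_gaussian_mul_phase (by norm_num), hf, gaussian]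
  rw [Complex.real_smul]
  push_cast
  have e5 : ‖v - u‖ ^ 2 + ‖u + v‖ ^ 2 = 2 * (‖u‖ ^ 2 + ‖v‖ ^ 2) := by
    have := parallelogram_law_with_norm ℝ v u
    rw [add_comm v u] at this
    nlinarith [this]
  have e6 : ‖a‖ ^ 2 = ‖v - u‖ ^ 2 / 4 := by
    rw [ha, norm_smul]
    norm_num
    ring
  have e7 : (‖v - u‖ ^ 2 + ‖u + v‖ ^ 2 : ℂ) = 2 * (‖u‖ ^ 2 + ‖v‖ ^ 2) := by exact_mod_cast e5
  have e8 : (‖a‖ ^ 2 : ℂ) = ‖v - u‖ ^ 2 / 4 := by exact_mod_cast e6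
  rw [norm_complexStructure hω hJ hJJ, mul_left_comm, ← Complex.exp_add, mul_assoc,
    ← Complex.exp_add]
  congr 2
  linear_combination (-1 / 2 : ℂ) * e8 - (1 / 8 : ℂ) * e7

/-- Averaging the translates of the vacuum projection by a Gaussian yields a narrower Gaussian. -/
theorem integral_gaussian_smul_conj_smear (hW : IsWeylSystem ω W) (hω : ω.IsAlt)
    (hJ : ∀ z w, ω z w = ⟪J z, w⟫_ℝ) (hJJ : ∀ z, J (J z) = -z) {b : ℝ} (hb : 0 < b) (x : H) :
    ∫ w, gaussian b w • W w (smear W (gaussian (1 / 4)) (W (-w) x)) =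
      gaussianMass V b • smear W (gaussian (1 / 4 + 1 / (4 * b))) x := by
  set f : V → ℂ := gaussian (1 / 4) with hf
  have hfi : Integrable f := integrable_gaussian (by norm_num)
  have hfc : Continuous f := continuous_gaussian _
  have hgc : Continuous (gaussian b : V → ℂ) := continuous_gaussian _
  have hωc : Continuous fun q : V × V => ω q.1 q.2 := by
    have hJc : Continuous J := J.continuous_of_finiteDimensional
    simp only [hJ]
    fun_prop
  have h1 : ∀ w, gaussian b w • W w (smear W f (W (-w) x)) =
      ∫ z, (gaussian b w * f z * phase (ω w z)) • W z x := by
    intro w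
    rw [hW.map_smear hfi, ← integral_smul]
    congr 1
    funext z
    rw [hW.apply_comm hω w z, hW.apply_neg_apply hω, smul_smul, smul_smul, mul_assoc]
  simp only [h1]
  rw [integral_integral_swap, smear, ← integral_smul]
  · congr 1
    funext z
    rw [integral_smul_const, ← smul_assoc]
    congr 1
    have h2 : ∀ w, gaussian b w * f z * phase (ω w z) =
        f z * (gaussian b w * phase (-1 * ⟪J z, w⟫_ℝ)) := by
      intro w
      rw [← hJ, neg_one_mul, hω.neg]
      ring
    simp only [h2]
    rw [integral_const_mul, integral_gaussian_mul_phase hb, norm_complexStructure hω hJ hJJ, hf,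
      Complex.real_smul, mul_left_comm, gaussian, gaussian, ← Complex.exp_add]
    congr 2
    push_cast
    have : (b : ℂ) ≠ 0 := by exact_mod_cast hb.ne'
    field_simp
    ring
  · have h3 : Integrable (fun q : V × V => gaussian b q.1 * f q.2) (volume.prod volume) :=
      (integrable_gaussian hb).mul_prod hfi
    refine (h3.norm.mul_const ‖x‖).mono' (Continuous.aestronglyMeasurable ?_)
      (Filter.Eventually.of_forall fun q => ?_)
    · have h5 : Continuous fun q : V × V => W q.2 x := (hW.continuous x).comp continuous_snd
      exact (((hgc.comp continuous_fst).mul (hfc.comp continuous_snd)).mul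
        (continuous_phase.comp hωc)).smul h5
    · simp [Function.uncurry, norm_smul, norm_phase, hW.norm_apply]

/-- Narrow Gaussians are approximate identities, with a rate on vectors along which `W` is
Lipschitz at the origin up to `η`. -/
theorem norm_smear_gaussian_sub_le (hW : IsWeylSystem ω W) {b : ℝ} (hb : 0 < b) {x : H} {η L : ℝ}
    (hL : 0 ≤ L) (hx : ∀ z, ‖W z x - x‖ ≤ η + L * ‖z‖) :
    ‖(gaussianMass V b)⁻¹ • smear W (gaussian b) x - x‖ ≤
      η + L * (Real.sqrt (2 / b) * 2 ^ (Module.finrank ℝ V / 2 : ℝ)) := by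
  have hM := gaussianMass_pos (V := V) hb
  have hi := integrable_exp_neg_mul_sq (V := V) hb
  have hi2 := integrable_exp_neg_mul_sq (V := V) (half_pos hb)
  have h1 : smear W (gaussian b) x - gaussianMass V b • x =
      ∫ z : V, Real.exp (-b * ‖z‖ ^ 2) • (W z x - x) := by
    have h2 := hW.integrable_smul_apply (integrable_gaussian hb) x
    simp only [gaussian_eq_ofReal, Complex.coe_smul] at h2
    simp only [smul_sub]
    rw [integral_sub h2 (hi.smul_const x), integral_smul_const, integral_exp_neg_mul_sq hb, smear]
    simp only [gaussian_eq_ofReal, Complex.coe_smul]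
  have h3 : ∀ z : V, ‖Real.exp (-b * ‖z‖ ^ 2) • (W z x - x)‖ ≤
      Real.exp (-b * ‖z‖ ^ 2) * η +
        Real.exp (-(b / 2) * ‖z‖ ^ 2) * (L * Real.sqrt (2 / b)) := by
    intro z
    rw [norm_smul, Real.norm_eq_abs, Real.abs_exp]
    -- `s ≤ e^{s²}` with `s = √(b/2) ‖z‖` trades the factor `‖z‖` for half of the Gaussian
    have h4 : ‖z‖ * Real.exp (-b * ‖z‖ ^ 2) ≤
        Real.sqrt (2 / b) * Real.exp (-(b / 2) * ‖z‖ ^ 2) := by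
      set s := Real.sqrt (b / 2) * ‖z‖ with hs
      have hs2 : s ^ 2 = b / 2 * ‖z‖ ^ 2 := by rw [hs, mul_pow, Real.sq_sqrt (by positivity)]
      have hz : ‖z‖ = Real.sqrt (2 / b) * s := by
        rw [hs, ← mul_assoc, ← Real.sqrt_mul (by positivity)]
        have : 2 / b * (b / 2) = 1 := by field_simp
        rw [this, Real.sqrt_one, one_mul]
      have h5 : s ≤ Real.exp (b / 2 * ‖z‖ ^ 2) := by
        rw [← hs2]
        nlinarith [Real.add_one_le_exp (s ^ 2), sq_nonneg (s - 1)]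
      have h6 : Real.exp (-(b / 2) * ‖z‖ ^ 2) =
          Real.exp (b / 2 * ‖z‖ ^ 2) * Real.exp (-b * ‖z‖ ^ 2) := by
        rw [← Real.exp_add]
        ring_nf
      rw [h6, ← mul_assoc]
      refine mul_le_mul_of_nonneg_right ?_ (Real.exp_pos _).le
      calc ‖z‖ = Real.sqrt (2 / b) * s := hz
        _ ≤ _ := mul_le_mul_of_nonneg_left h5 (Real.sqrt_nonneg _)
    calc _ ≤ Real.exp (-b * ‖z‖ ^ 2) * (η + L * ‖z‖) :=
          mul_le_mul_of_nonneg_left (hx z) (Real.exp_pos _).le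
      _ = Real.exp (-b * ‖z‖ ^ 2) * η + L * (‖z‖ * Real.exp (-b * ‖z‖ ^ 2)) := by ring
      _ ≤ _ := by
          have := mul_le_mul_of_nonneg_left h4 hL
          linarith
  have h7 : ‖smear W (gaussian b) x - gaussianMass V b • x‖ ≤
      gaussianMass V b * η + gaussianMass V (b / 2) * (L * Real.sqrt (2 / b)) := by
    rw [h1]
    refine (norm_integral_le_of_norm_le ((hi.mul_const η).add (hi2.mul_const _))
      (Filter.Eventually.of_forall h3)).trans_eq ?_
    simp only [Pi.add_apply]
    rw [integral_add (hi.mul_const η) (hi2.mul_const _), integral_mul_const, integral_mul_const,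
      integral_exp_neg_mul_sq hb, integral_exp_neg_mul_sq (half_pos hb)]
  have h8 : gaussianMass V (b / 2) =
      gaussianMass V b * 2 ^ (Module.finrank ℝ V / 2 : ℝ) := by
    rw [gaussianMass, gaussianMass, ← Real.mul_rpow (by positivity) (by positivity)]
    congr 1
    field_simp
  have h9 : (gaussianMass V b)⁻¹ • smear W (gaussian b) x - x =
      (gaussianMass V b)⁻¹ • (smear W (gaussian b) x - gaussianMass V b • x) := by
    rw [smul_sub, inv_smul_smul₀ hM.ne']
  rw [h9, norm_smul, norm_inv, Real.norm_of_nonneg hM.le, inv_mul_le_iff₀ hM]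
  refine h7.trans_eq ?_
  rw [h8]
  ring

end IsWeylSystem

/-- The error bound of `norm_smear_gaussian_sub_le` at the widths that
`integral_gaussian_smul_conj_smear` produces can be made arbitrarily small. -/
theorem exists_width_lt (L K : ℝ) {ε : ℝ} (hε : 0 < ε) (hL : 0 ≤ L) (hK : 0 ≤ K) :
    ∃ b : ℝ, 0 < b ∧ L * (Real.sqrt (2 / (1 / 4 + 1 / (4 * b))) * K) < ε := by
  have h1 : Tendsto (fun b : ℝ => L * (Real.sqrt (8 * b) * K)) (𝓝[>] 0) (𝓝 0) := by
    have : Continuous fun b : ℝ => L * (Real.sqrt (8 * b) * K) := by fun_prop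
    have := this.tendsto 0
    simp only [mul_zero, Real.sqrt_zero, zero_mul] at this
    exact this.mono_left nhdsWithin_le_nhds
  obtain ⟨b, hb, hb0⟩ := ((h1.eventually (gt_mem_nhds hε)).and self_mem_nhdsWithin).exists
  have hb0 : 0 < b := hb0
  refine ⟨b, hb0, lt_of_le_of_lt ?_ hb⟩
  have h2 : 2 / (1 / 4 + 1 / (4 * b)) ≤ 8 * b := by
    rw [div_le_iff₀ (by positivity)]
    field_simp
    nlinarith
  gcongr

namespace IsWeylSystem

variable {H : Type*} [NormedAddCommGroup H] [InnerProductSpace ℂ H] [CompleteSpace H]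
  {V : Type*} [NormedAddCommGroup V] [InnerProductSpace ℝ V] [FiniteDimensional ℝ V]
  [MeasurableSpace V] [BorelSpace V]
  {ω : V →ₗ[ℝ] V →ₗ[ℝ] ℝ} {W : V → H →L[ℂ] H} {J : V →ₗ[ℝ] V}

omit [FiniteDimensional ℝ V] [MeasurableSpace V] [BorelSpace V] in
/-- Strong continuity at `0`, in the form required by `norm_smear_gaussian_sub_le`. -/
theorem exists_norm_apply_sub_le (hW : IsWeylSystem ω W) (x : H) {η : ℝ} (hη : 0 < η) :
    ∃ L : ℝ, 0 ≤ L ∧ ∀ z, ‖W z x - x‖ ≤ η + L * ‖z‖ := by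
  have h1 : ContinuousAt (fun z => W z x) 0 := (hW.continuous x).continuousAt
  obtain ⟨δ, hδ, h2⟩ := Metric.continuousAt_iff.1 h1 η hη
  simp only [hW.zero, one_apply_eq_self, dist_eq_norm, sub_zero] at h2
  refine ⟨2 * ‖x‖ / δ, by positivity, fun z => ?_⟩
  rcases lt_or_ge ‖z‖ δ with hz | hz
  · have : 0 ≤ 2 * ‖x‖ / δ * ‖z‖ := by positivity
    linarith [h2 hz]
  · have h3 : ‖W z x - x‖ ≤ 2 * ‖x‖ := by
      refine (norm_sub_le _ _).trans_eq ?_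
      rw [hW.norm_apply, two_mul]
    have h4 : 2 * ‖x‖ ≤ 2 * ‖x‖ / δ * ‖z‖ := by
      rw [div_mul_eq_mul_div, le_div_iff₀ hδ]
      gcongr
    linarith

/-- A vacuum vector: a fixed vector of the vacuum projection, which is
`smear W (gaussian (1 / 4))` divided by the constant `gaussianMass V (1 / 2)`. This bounded
description of the vectors annihilated by all `P(Ju) + i P(u)` avoids domains. -/
def _root_.Weyl.IsVacuum (W : V → H →L[ℂ] H) (Ω : H) : Prop :=
  smear W (gaussian (1 / 4)) Ω = gaussianMass V (1 / 2) • Ω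

theorem isVacuum_smear (hW : IsWeylSystem ω W) (hω : ω.IsAlt)
    (hJ : ∀ z w, ω z w = ⟪J z, w⟫_ℝ) (hJJ : ∀ z, J (J z) = -z) (x : H) :
    IsVacuum W (smear W (gaussian (1 / 4)) x) := by
  have := hW.smear_gaussian_apply_smear_gaussian hω hJ hJJ 0 x
  simpa [hW.zero, IsVacuum] using this

/-- If the vacuum projection vanished, then so would all narrow Gaussian averages of `W`, which are
averages of its conjugates. -/
theorem exists_isVacuum [Nontrivial H] (hW : IsWeylSystem ω W) (hω : ω.IsAlt)
    (hJ : ∀ z w, ω z w = ⟪J z, w⟫_ℝ) (hJJ : ∀ z, J (J z) = -z) :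
    ∃ Ω : H, Ω ≠ 0 ∧ IsVacuum W Ω := by
  by_contra! hcon
  have h0 : ∀ x, smear W (gaussian (1 / 4)) x = 0 := by
    intro x
    by_contra h
    exact hcon _ h (hW.isVacuum_smear hω hJ hJJ x)
  obtain ⟨x, hx⟩ := exists_ne (0 : H)
  refine hx (norm_le_zero_iff.1 (le_of_forall_pos_le_add fun ε hε => ?_))
  obtain ⟨L, hL, hLx⟩ := hW.exists_norm_apply_sub_le x (half_pos hε)
  obtain ⟨b, hb, hbε⟩ := exists_width_lt L (2 ^ (Module.finrank ℝ V / 2 : ℝ)) (half_pos hε) hL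
    (by positivity)
  have h1 := hW.integral_gaussian_smul_conj_smear hω hJ hJJ hb x
  simp only [h0, map_zero, smul_zero, integral_zero] at h1
  have h2 : smear W (gaussian (1 / 4 + 1 / (4 * b))) x = 0 :=
    (smul_eq_zero.1 h1.symm).resolve_left (gaussianMass_pos hb).ne'
  have h3 := hW.norm_smear_gaussian_sub_le (b := 1 / 4 + 1 / (4 * b)) (by positivity) hL hLx
  rw [h2, smul_zero, zero_sub, norm_neg] at h3
  linarith

/-- The characteristic function of the vacuum state. -/
theorem inner_vacuum_apply (hW : IsWeylSystem ω W) (hω : ω.IsAlt)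
    (hJ : ∀ z w, ω z w = ⟪J z, w⟫_ℝ) (hJJ : ∀ z, J (J z) = -z) {Ω Ω' : H} (hΩ : IsVacuum W Ω)
    (hΩ' : IsVacuum W Ω') (u : V) :
    ⟪Ω, W u Ω'⟫_ℂ = Real.exp (-‖u‖ ^ 2 / 4) * ⟪Ω, Ω'⟫_ℂ := by
  have hM : (gaussianMass V (1 / 2) : ℂ) ≠ 0 := by
    exact_mod_cast (gaussianMass_pos (V := V) (by norm_num : (0 : ℝ) < 1 / 2)).ne'
  have h1 := hW.smear_gaussian_apply_smear_gaussian hω hJ hJJ u Ω'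
  have h2 := hW.inner_smear_left hω (integrable_gaussian (V := V) (by norm_num : (0 : ℝ) < 1 / 4))
    (conj_gaussian_neg _) Ω (W u (smear W (gaussian (1 / 4)) Ω'))
  rw [h1, hΩ, hΩ'] at h2
  simp only [← Complex.coe_smul, map_smul, inner_smul_left, inner_smul_right, Complex.conj_ofReal,
    Complex.ofReal_mul] at h2
  refine mul_left_cancel₀ (mul_ne_zero hM hM) ?_
  linear_combination h2

/-- The Gram matrix of the coherent states `W(z) Ω`. -/
theorem inner_apply_vacuum_apply_vacuum (hW : IsWeylSystem ω W) (hω : ω.IsAlt)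
    (hJ : ∀ z w, ω z w = ⟪J z, w⟫_ℝ) (hJJ : ∀ z, J (J z) = -z) {Ω : H} (hΩ : IsVacuum W Ω)
    (z w : V) :
    ⟪W z Ω, W w Ω⟫_ℂ = phase (-ω z w / 2) * Real.exp (-‖w - z‖ ^ 2 / 4) * ‖Ω‖ ^ 2 := by
  rw [hW.inner_apply_left hω, hW.apply_apply, inner_smul_right,
    hW.inner_vacuum_apply hω hJ hJJ hΩ hΩ, neg_add_eq_sub, inner_self_eq_norm_sq_to_K]
  simp [mul_assoc]

/-- The right-hand side is `o(t²)`: to first order in `t`, the vacuum is annihilated by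
`P(Ju) + i P(u)`. -/
theorem norm_sq_annihilation_difference (hW : IsWeylSystem ω W) (hω : ω.IsAlt)
    (hJ : ∀ z w, ω z w = ⟪J z, w⟫_ℝ) (hJJ : ∀ z, J (J z) = -z) {Ω : H} (hΩ : IsVacuum W Ω)
    {u : V} (hu : ‖u‖ = 1) (t : ℝ) :
    ‖W (t • -J u) Ω + I • W (t • -u) Ω - (1 + I) • Ω‖ ^ 2 =
      (4 - 2 * Real.exp (-(t ^ 2) / 2) * Real.sin (t ^ 2 / 2) - 4 * Real.exp (-(t ^ 2) / 4)) *
        ‖Ω‖ ^ 2 := by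
  have hJu : ‖J u‖ = 1 := by rw [norm_complexStructure hω hJ hJJ, hu]
  have h1 : ∀ v : V, ‖v‖ = 1 → ⟪Ω, W (t • -v) Ω⟫_ℂ = Real.exp (-(t ^ 2) / 4) * ‖Ω‖ ^ 2 := by
    intro v hv
    rw [hW.inner_vacuum_apply hω hJ hJJ hΩ hΩ, norm_smul, norm_neg, hv, mul_one, Real.norm_eq_abs,
      sq_abs, inner_self_eq_norm_sq_to_K]
    simp
  have h1' : ∀ v : V, ‖v‖ = 1 → ⟪W (t • -v) Ω, Ω⟫_ℂ = Real.exp (-(t ^ 2) / 4) * ‖Ω‖ ^ 2 := by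
    intro v hv
    rw [← inner_conj_symm, h1 v hv]
    simp only [map_mul, map_pow, Complex.conj_ofReal]
  have horth : ⟪u, J u⟫_ℝ = 0 := by
    rw [real_inner_comm, ← hJ, hω.self_eq_zero]
  have h2 : ⟪W (t • -J u) Ω, W (t • -u) Ω⟫_ℂ =
      phase (t ^ 2 / 2) * Real.exp (-(t ^ 2) / 2) * ‖Ω‖ ^ 2 := by
    rw [hW.inner_apply_vacuum_apply_vacuum hω hJ hJJ hΩ]
    have e1 : -ω (t • -J u) (t • -u) / 2 = t ^ 2 / 2 := by
      simp only [map_smul, map_neg, LinearMap.smul_apply, LinearMap.neg_apply, hJ, hJJ, smul_eq_mul,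
        inner_neg_left, real_inner_self_eq_norm_sq, hu]
      ring
    have e2 : ‖t • -u - t • -J u‖ ^ 2 = 2 * t ^ 2 := by
      rw [← smul_sub, norm_smul, mul_pow, Real.norm_eq_abs, sq_abs, neg_sub_neg,
        @norm_sub_sq_real, hJu, hu, real_inner_comm, horth]
      ring
    rw [e1, e2]
    congr 4
    ring
  have h3 : ⟪W (t • -u) Ω, W (t • -J u) Ω⟫_ℂ =
      phase (-(t ^ 2 / 2)) * Real.exp (-(t ^ 2) / 2) * ‖Ω‖ ^ 2 := by
    rw [← inner_conj_symm, h2]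
    simp only [map_mul, map_pow, Complex.conj_ofReal, conj_phase]
  have hself : ∀ v, ⟪W v Ω, W v Ω⟫_ℂ = ‖Ω‖ ^ 2 := by
    intro v
    rw [inner_self_eq_norm_sq_to_K, hW.norm_apply]
    rfl
  have hp : I * phase (t ^ 2 / 2) - I * phase (-(t ^ 2 / 2)) = -2 * Real.sin (t ^ 2 / 2) := by
    rw [Complex.ofReal_sin, Complex.sin, phase, phase]
    push_cast
    simp only [mul_comm I]
    rw [neg_mul]
    ring
  have h4 : ((‖W (t • -J u) Ω + I • W (t • -u) Ω - (1 + I) • Ω‖ : ℂ)) ^ 2 =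
      ((4 - 2 * Real.exp (-(t ^ 2) / 2) * Real.sin (t ^ 2 / 2) - 4 * Real.exp (-(t ^ 2) / 4)) *
        ‖Ω‖ ^ 2 : ℝ) := by
    have := inner_self_eq_norm_sq_to_K (𝕜 := ℂ)
      (W (t • -J u) Ω + I • W (t • -u) Ω - (1 + I) • Ω)
    simp only [Complex.coe_algebraMap] at this
    rw [← this]
    simp only [inner_sub_left, inner_sub_right, inner_add_left, inner_add_right, inner_smul_left,
      inner_smul_right, h1 _ hu, h1 _ hJu, h1' _ hu, h1' _ hJu, h2, h3, hself, map_add, map_one,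
      Complex.conj_I]
    simp only [inner_self_eq_norm_sq_to_K, Complex.coe_algebraMap]
    push_cast
    push_cast at hp
    linear_combination (Complex.exp (-(t ^ 2 : ℂ) / 2) * (‖Ω‖ : ℂ) ^ 2) * hp +
      (-2 * (‖Ω‖ : ℂ) ^ 2 + 2 * Complex.exp (-(t ^ 2 : ℂ) / 4) * (‖Ω‖ : ℂ) ^ 2) * Complex.I_sq
  exact_mod_cast h4

/-- Vacuum vectors are annihilated, in the weak sense, by `P(Ju) + i P(u)`. -/
theorem inner_vacuum_generator (hW : IsWeylSystem ω W) (hω : ω.IsAlt)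
    (hJ : ∀ z w, ω z w = ⟪J z, w⟫_ℝ) (hJJ : ∀ z, J (J z) = -z) {Ω : H} (hΩ : IsVacuum W Ω)
    {u : V} (hu : ‖u‖ = 1) {y yJ yu : H} (hyJ : HasGenerator W (J u) y yJ)
    (hyu : HasGenerator W u y yu) : ⟪Ω, yJ⟫_ℂ = I * ⟪Ω, yu⟫_ℂ := by
  have hF : HasDerivAt (fun t : ℝ => ⟪Ω, W (t • J u) y⟫_ℂ - I * ⟪Ω, W (t • u) y⟫_ℂ)
      (I * (⟪Ω, yJ⟫_ℂ - I * ⟪Ω, yu⟫_ℂ)) 0 := by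
    have h1 := (hasDerivAt_const (0 : ℝ) Ω).inner ℂ hyJ
    have h2 := ((hasDerivAt_const (0 : ℝ) Ω).inner ℂ hyu).const_mul I
    convert! h1.sub h2 using 1
    simp [inner_smul_right]
    ring
  set F := fun t : ℝ => ⟪Ω, W (t • J u) y⟫_ℂ - I * ⟪Ω, W (t • u) y⟫_ℂ with hFdef
  set g : ℝ → ℝ := fun r =>
    4 - 2 * Real.exp (-r / 2) * Real.sin (r / 2) - 4 * Real.exp (-r / 4) with hg
  have hg0 : g 0 = 0 := by simp [hg]
  have hgd : HasDerivAt g 0 0 := by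
    have e1 : HasDerivAt (fun r : ℝ => Real.exp (-r / 2)) (-1 / 2) 0 := by
      simpa using! ((hasDerivAt_id (0 : ℝ)).neg.div_const 2).exp
    have e2 : HasDerivAt (fun r : ℝ => Real.sin (r / 2)) (1 / 2) 0 := by
      simpa using! ((hasDerivAt_id (0 : ℝ)).div_const 2).sin
    have e3 : HasDerivAt (fun r : ℝ => Real.exp (-r / 4)) (-1 / 4) 0 := by
      simpa using! ((hasDerivAt_id (0 : ℝ)).neg.div_const 4).exp
    convert! (((e1.const_mul 2).mul e2).const_sub 4).sub (e3.const_mul 4) using 1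
    simp
    norm_num
  have hbound : ∀ t : ℝ, ‖F t - F 0‖ ^ 2 ≤ g (t ^ 2) * (‖Ω‖ ^ 2 * ‖y‖ ^ 2) := by
    intro t
    have e1 : F t - F 0 = ⟪W (t • -J u) Ω + I • W (t • -u) Ω - (1 + I) • Ω, y⟫_ℂ := by
      simp only [hFdef, inner_sub_left, inner_add_left, inner_smul_left, hW.inner_apply_left hω,
        smul_neg, neg_neg, zero_smul, hW.zero, one_apply_eq_self, map_add, map_one, Complex.conj_I]
      ring
    rw [e1, ← mul_assoc, ← hW.norm_sq_annihilation_difference hω hJ hJJ hΩ hu t, ← mul_pow]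
    exact pow_le_pow_left₀ (norm_nonneg _) (norm_inner_le_norm _ _) 2
  have hsq : Tendsto (fun t : ℝ => t ^ 2) (𝓝[≠] 0) (𝓝[≠] 0) := by
    refine tendsto_nhdsWithin_iff.2 ⟨?_, ?_⟩
    · have : Continuous fun t : ℝ => t ^ 2 := by fun_prop
      simpa using (this.tendsto 0).mono_left nhdsWithin_le_nhds
    · filter_upwards [self_mem_nhdsWithin] with t ht
      exact pow_ne_zero 2 ht
  have h1 : Tendsto (fun t => ‖slope F 0 t‖ ^ 2) (𝓝[≠] 0)
      (𝓝 (‖I * (⟪Ω, yJ⟫_ℂ - I * ⟪Ω, yu⟫_ℂ)‖ ^ 2)) :=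
    ((hasDerivAt_iff_tendsto_slope.1 hF).norm).pow 2
  have h2 : Tendsto (fun t : ℝ => slope g 0 (t ^ 2) * (‖Ω‖ ^ 2 * ‖y‖ ^ 2)) (𝓝[≠] 0) (𝓝 0) := by
    simpa using ((hasDerivAt_iff_tendsto_slope.1 hgd).comp hsq).mul_const (‖Ω‖ ^ 2 * ‖y‖ ^ 2)
  have h3 : ‖I * (⟪Ω, yJ⟫_ℂ - I * ⟪Ω, yu⟫_ℂ)‖ ^ 2 ≤ 0 := by
    refine le_of_tendsto_of_tendsto h1 h2 ?_
    filter_upwards [self_mem_nhdsWithin] with t ht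
    have ht : t ≠ 0 := ht
    have h4 : 0 < t ^ 2 := by positivity
    rw [slope_def_module, slope_def_field, norm_smul, mul_pow, hg0, sub_zero, sub_zero, sub_zero,
      norm_inv, Real.norm_eq_abs, inv_pow, sq_abs, div_mul_eq_mul_div, inv_mul_eq_div]
    exact div_le_div_of_nonneg_right (hbound t) h4.le
  have h5 : I * (⟪Ω, yJ⟫_ℂ - I * ⟪Ω, yu⟫_ℂ) = 0 := by
    have := le_antisymm h3 (sq_nonneg _)
    simpa using this
  exact sub_eq_zero.1 ((mul_eq_zero.1 h5).resolve_left Complex.I_ne_zero)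

/-! ### Compactness in irreducible Weyl systems -/

/-- In an irreducible Weyl system the vacuum is unique, so that smearing with the vacuum Gaussian
gives a multiple of a rank-one projection. -/
theorem smear_gaussian_eq_inner_smul (hW : IsWeylSystem ω W) (hω : ω.IsAlt)
    (hJ : ∀ z w, ω z w = ⟪J z, w⟫_ℝ) (hJJ : ∀ z, J (J z) = -z)
    (hirr : ∀ S : Submodule ℂ H, IsClosed (S : Set H) → (∀ z, ∀ x ∈ S, W z x ∈ S) → S = ⊥ ∨ S = ⊤)
    {Ω : H} (hΩ : IsVacuum W Ω) (hΩ0 : Ω ≠ 0) (x : H) :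
    smear W (gaussian (1 / 4)) x =
      ((gaussianMass V (1 / 2) / ‖Ω‖ ^ 2 : ℝ) : ℂ) • ⟪Ω, x⟫_ℂ • Ω := by
  have hfi := integrable_gaussian (V := V) (by norm_num : (0 : ℝ) < 1 / 4)
  have hΩn : (‖Ω‖ : ℂ) ≠ 0 := by simpa using hΩ0
  -- the cyclic subspace of a vacuum vector is everything, so no second vacuum is orthogonal to it
  have huniq : ∀ y, IsVacuum W y → ⟪y, Ω⟫_ℂ = 0 → y = 0 := by
    intro y hy hyΩ
    let S : Submodule ℂ H := ⨅ z, (ℂ ∙ (W z y))ᗮ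
    have hS : ∀ v, v ∈ S ↔ ∀ z, ⟪W z y, v⟫_ℂ = 0 := by
      intro v
      simp [S, Submodule.mem_iInf, Submodule.mem_orthogonal_singleton_iff_inner_right]
    have hSc : IsClosed (S : Set H) := by
      simp only [S, Submodule.coe_iInf]
      exact isClosed_iInter fun z => Submodule.isClosed_orthogonal _
    have hΩS : Ω ∈ S := by
      rw [hS]
      intro z
      rw [← inner_conj_symm, hW.inner_vacuum_apply hω hJ hJJ hΩ hy, ← inner_conj_symm, hyΩ]
      simp
    rcases hirr S hSc (fun z v hv => by
      rw [hS] at hv ⊢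
      intro w
      have h1 := hW.inner_apply_left hω (-z) (W w y) v
      rw [neg_neg] at h1
      rw [← h1, hW.apply_apply, inner_smul_left, hv, mul_zero]) with h | h
    · rw [h, Submodule.mem_bot] at hΩS
      exact absurd hΩS hΩ0
    · have hyS : y ∈ S := h ▸ Submodule.mem_top
      have := (hS y).1 hyS 0
      simpa [hW.zero] using this
  set y := smear W (gaussian (1 / 4)) x with hy
  have hyv : IsVacuum W y := hW.isVacuum_smear hω hJ hJJ x
  set c : ℂ := ⟪Ω, y⟫_ℂ / ‖Ω‖ ^ 2 with hc
  have hvac : IsVacuum W (y + (-c) • Ω) := by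
    rw [IsVacuum, hW.smear_add hfi, smear_smul, hyv, hΩ, smul_add, smul_comm]
  have h0 := huniq _ hvac (by
    rw [← inner_conj_symm, inner_add_right, inner_smul_right, inner_self_eq_norm_sq_to_K, hc]
    simp only [Complex.coe_algebraMap]
    field_simp
    simp)
  have h1 : y = c • Ω := by
    rw [neg_smul, ← sub_eq_add_neg, sub_eq_zero] at h0
    exact h0
  have h2 : ⟪Ω, y⟫_ℂ = gaussianMass V (1 / 2) * ⟪Ω, x⟫_ℂ := by
    rw [hy, ← hW.inner_smear_left hω hfi (conj_gaussian_neg _), hΩ, ← Complex.coe_smul,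
      inner_smul_left, Complex.conj_ofReal]
  rw [h1, hc, h2, smul_smul]
  congr 1
  push_cast
  ring

/-- In an irreducible Weyl system, smearing with a narrow Gaussian is an integral of rank-one
operators, hence a compact operator. -/
theorem exists_isCompactOperator_smear_gaussian [Nontrivial H] (hW : IsWeylSystem ω W)
    (hω : ω.IsAlt)
    (hJ : ∀ z w, ω z w = ⟪J z, w⟫_ℝ) (hJJ : ∀ z, J (J z) = -z)
    (hirr : ∀ S : Submodule ℂ H, IsClosed (S : Set H) → (∀ z, ∀ x ∈ S, W z x ∈ S) → S = ⊥ ∨ S = ⊤)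
    {b : ℝ} (hb : 0 < b) :
    ∃ A : H →L[ℂ] H, IsCompactOperator A ∧
      ∀ x, A x = smear W (gaussian (1 / 4 + 1 / (4 * b))) x := by
  obtain ⟨Ω, hΩ0, hΩ⟩ := hW.exists_isVacuum hω hJ hJJ
  set K := compactOperator (RingHom.id ℂ) H H with hK
  have hKc : IsClosed (K : Set (H →L[ℂ] H)) := isClosed_setOfPred_isCompactOperator
  have : CompleteSpace K := hKc.completeSpace_coe
  set c : ℝ := gaussianMass V (1 / 2) / ‖Ω‖ ^ 2 with hc
  have hr : ∀ v : H, InnerProductSpace.rankOne ℂ v v ∈ K := by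
    intro v
    change IsCompactOperator _
    have h1 : (InnerProductSpace.rankOne ℂ v v : H → H) =
        (ContinuousLinearMap.toSpanSingleton ℂ v) ∘ (innerSL ℂ v) := by
      ext x
      simp
    rw [h1]
    exact (isCompactOperator_of_locallyCompactSpace_dom (innerSL ℂ v)).clm_comp _
  -- integrating in the Banach space `K` of compact operators keeps the integral compact
  let Φ : V → K := fun w => (gaussian b w * c) • ⟨InnerProductSpace.rankOne ℂ (W w Ω) (W w Ω), hr _⟩
  have hΦc : Continuous Φ := by
    have h1 : Continuous fun w => InnerProductSpace.rankOne ℂ (W w Ω) (W w Ω) := by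
      have := hW.continuous Ω
      have h2 := (ContinuousLinearMap.smulRightL ℂ H H).continuous₂.comp
        (((innerSL ℂ).continuous.comp this).prodMk this)
      convert! h2 using 1
    exact ((continuous_gaussian b).mul continuous_const).smul (h1.subtype_mk _)
  have hΦi : Integrable Φ := by
    have := FiniteDimensional.proper_real V
    have : SecondCountableTopologyEither V K := secondCountableTopologyEither_of_left V K
    refine (((integrable_gaussian hb).norm.mul_const (|c| * (‖Ω‖ * ‖Ω‖)))).mono'
      hΦc.aestronglyMeasurable (Eventually.of_forall fun w => ?_)
    simp only [Φ]
    rw [norm_smul, norm_mul, Complex.norm_real, Real.norm_eq_abs, mul_assoc]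
    gcongr
    change ‖InnerProductSpace.rankOne ℂ (W w Ω) (W w Ω)‖ ≤ _
    rw [InnerProductSpace.norm_rankOne, hW.norm_apply]
  refine ⟨((gaussianMass V b)⁻¹ : ℂ) • ((∫ w, Φ w : K) : H →L[ℂ] H), ?_, fun x => ?_⟩
  · exact IsCompactOperator.smul (∫ w, Φ w : K).2 _
  · have h1 : ((∫ w, Φ w : K) : H →L[ℂ] H) = ∫ w, (Φ w : H →L[ℂ] H) :=
      (K.subtypeL.integral_comp_comm hΦi).symm
    have h2 : Integrable fun w => (Φ w : H →L[ℂ] H) := K.subtypeL.integrable_comp hΦi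
    have h3 : ∀ w, (Φ w : H →L[ℂ] H) x =
        gaussian b w • W w (smear W (gaussian (1 / 4)) (W (-w) x)) := by
      intro w
      rw [hW.smear_gaussian_eq_inner_smul hω hJ hJJ hirr hΩ hΩ0, map_smul, map_smul,
        ← hW.inner_apply_left hω]
      simp [Φ, mul_smul, hc]
    rw [_root_.smul_apply, h1, ContinuousLinearMap.integral_apply h2]
    simp only [h3]
    rw [hW.integral_gaussian_smul_conj_smear hω hJ hJJ hb, ← Complex.coe_smul, smul_smul,
      inv_mul_cancel₀, one_smul]
    exact_mod_cast (gaussianMass_pos hb).ne'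

/-- In an irreducible Weyl system, bounded sets on which `W` is uniformly Lipschitz at the origin
are totally bounded: the common domain of the generators embeds compactly into `H`. -/
theorem totallyBounded_of_norm_apply_sub_le [Nontrivial H] (hW : IsWeylSystem ω W)
    (hω : ω.IsAlt)
    (hJ : ∀ z w, ω z w = ⟪J z, w⟫_ℝ) (hJJ : ∀ z, J (J z) = -z)
    (hirr : ∀ S : Submodule ℂ H, IsClosed (S : Set H) → (∀ z, ∀ x ∈ S, W z x ∈ S) → S = ⊥ ∨ S = ⊤)
    {S : Set H} (hS : Bornology.IsBounded S) {L : ℝ} (hL : 0 ≤ L)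
    (hSL : ∀ x ∈ S, ∀ z, ‖W z x - x‖ ≤ L * ‖z‖) : TotallyBounded S := by
  rw [Metric.totallyBounded_iff]
  intro ε hε
  obtain ⟨b, hb, hbε⟩ := exists_width_lt L (2 ^ (Module.finrank ℝ V / 2 : ℝ)) (half_pos hε) hL
    (by positivity)
  set β := 1 / 4 + 1 / (4 * b) with hβ
  have hβ0 : 0 < β := by positivity
  obtain ⟨A, hA, hAx⟩ := hW.exists_isCompactOperator_smear_gaussian hω hJ hJJ hirr hb
  have hA' : IsCompactOperator (((gaussianMass V β)⁻¹ : ℂ) • A : H →L[ℂ] H) := hA.smul _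
  have htb : TotallyBounded ((((gaussianMass V β)⁻¹ : ℂ) • A : H →L[ℂ] H) '' S) :=
    (IsCompactOperator.isCompact_closure_image_of_bounded
      (f := ((((gaussianMass V β)⁻¹ : ℂ) • A : H →L[ℂ] H) : H →ₗ[ℂ] H)) hA'
      hS).totallyBounded.subset subset_closure
  obtain ⟨T, hT, hTS⟩ := Metric.totallyBounded_iff.1 htb (ε / 2) (half_pos hε)
  refine ⟨T, hT, fun x hx => ?_⟩
  have h1 := hTS ⟨x, hx, rfl⟩
  simp only [Set.mem_iUnion, Metric.mem_ball, exists_prop] at h1 ⊢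
  obtain ⟨y, hy, hxy⟩ := h1
  refine ⟨y, hy, ?_⟩
  have h2 := hW.norm_smear_gaussian_sub_le (η := 0) hβ0 hL (fun z => by
    rw [zero_add]; exact hSL x hx z)
  rw [zero_add, ← hAx, ← Complex.coe_smul] at h2
  have h3 : dist x ((((gaussianMass V β)⁻¹ : ℂ) • A : H →L[ℂ] H) x) < ε / 2 := by
    rw [dist_comm, dist_eq_norm, _root_.smul_apply]
    push_cast at h2
    exact lt_of_le_of_lt h2 hbε
  linarith [dist_triangle x ((((gaussianMass V β)⁻¹ : ℂ) • A : H →L[ℂ] H) x) y]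

end IsWeylSystem

/-! ### Mollifiers -/

namespace IsWeylSystem

variable {H : Type*} [NormedAddCommGroup H] [InnerProductSpace ℂ H] [CompleteSpace H]
  {V : Type*} [NormedAddCommGroup V] [NormedSpace ℝ V] [FiniteDimensional ℝ V]
  [MeasureSpace V] [BorelSpace V] [(volume : Measure V).IsAddHaarMeasure]
  {W : V → H →L[ℂ] H}

omit [(volume : Measure V).IsAddHaarMeasure] in
/-- Smearing with an integrable function is a bounded operator. -/
theorem exists_smear_eq {ω : V →ₗ[ℝ] V →ₗ[ℝ] ℝ} (hW : IsWeylSystem ω W) {f : V → ℂ}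
    (hf : Integrable f) : ∃ R : H →L[ℂ] H, ∀ x, R x = smear W f x := by
  refine ⟨LinearMap.mkContinuous ⟨⟨smear W f, hW.smear_add hf⟩, fun c x => smear_smul c x⟩
    (∫ z, ‖f z‖) fun x => ?_, fun x => rfl⟩
  change ‖∫ z, f z • W z x‖ ≤ _
  refine (norm_integral_le_integral_norm _).trans_eq ?_
  simp only [norm_smul, hW.norm_apply]
  exact integral_mul_const _ _

/-- Commuting one-parameter groups have a mollifier: a bounded self-adjoint operator in their
commutant that maps into the common domain of the generators and moves a given vector by little. -/
theorem exists_mollifier (hW : IsWeylSystem (0 : V →ₗ[ℝ] V →ₗ[ℝ] ℝ) W) (x₀ : H) {ε : ℝ}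
    (hε : 0 < ε) :
    ∃ R : H →L[ℂ] H, (∀ x y, ⟪R x, y⟫_ℂ = ⟪x, R y⟫_ℂ) ∧ (∀ z x, W z (R x) = R (W z x)) ∧
      (∀ z x, ∃ y, HasGenerator W z (R x) y) ∧ ‖R x₀ - x₀‖ ≤ ε := by
  have halt : (0 : V →ₗ[ℝ] V →ₗ[ℝ] ℝ).IsAlt := fun x => rfl
  obtain ⟨δ, hδ, hδx⟩ := Metric.continuous_iff.1 (hW.continuous x₀) 0 ε hε
  let φ : ContDiffBump (0 : V) := ⟨δ / 2, δ, half_pos hδ, half_lt_self hδ⟩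
  set ρ : V → ℝ := φ.normed volume with hρ
  have hρi : Integrable fun z => (ρ z : ℂ) := φ.integrable_normed.ofReal
  have hρn : ∀ z, ρ (-z) = ρ z := φ.normed_neg
  obtain ⟨R, hR⟩ := hW.exists_smear_eq hρi
  have hcomm : ∀ z w x, W z (W w x) = W w (W z x) := by
    intro z w x
    rw [hW.apply_comm halt]
    simp [phase_zero]
  have hadd : ∀ z w x, W z (W w x) = W (z + w) x := by
    intro z w x
    rw [hW.apply_apply]
    simp [phase_zero]
  have hconv : ∀ z x, W z (R x) = (ρ ⋆[ContinuousLinearMap.lsmul ℝ ℝ] fun v => W v x) z := by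
    intro z x
    rw [hR, hW.map_smear hρi, convolution, ← integral_neg_eq_self]
    congr 1
    funext w
    rw [hadd, hρn, sub_eq_add_neg]
    simp
  refine ⟨R, fun x y => ?_, fun z x => ?_, fun z x => ?_, ?_⟩
  · rw [hR, hR]
    refine hW.inner_smear_left halt hρi (fun z => ?_) x y
    rw [hρn, Complex.conj_ofReal]
  · rw [hR, hR, hW.map_smear hρi, smear]
    simp only [hcomm z]
  · have := FiniteDimensional.proper_real V
    have h1 : ContDiff ℝ 1 (ρ ⋆[ContinuousLinearMap.lsmul ℝ ℝ] fun v => W v x) :=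
      φ.hasCompactSupport_normed.contDiff_convolution_left (n := 1) _ φ.contDiff_normed
        (hW.continuous x).locallyIntegrable
    have h2 : DifferentiableAt ℝ (fun t : ℝ => W (t • z) (R x)) 0 := by
      simp only [hconv]
      have h3 := (h1.differentiable one_ne_zero).comp
        (differentiable_id.smul_const z : Differentiable ℝ fun t : ℝ => t • z)
      exact h3.differentiableAt
    refine ⟨-I • deriv (fun t : ℝ => W (t • z) (R x)) 0, ?_⟩
    rw [HasGenerator, smul_smul]
    simpa using h2.hasDerivAt
  · have h1 := hconv 0 x₀
    rw [hW.zero, one_apply_eq_self] at h1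
    have := FiniteDimensional.proper_real V
    have h2 := φ.dist_normed_convolution_le (μ := volume) (x₀ := 0) (ε := ε)
      (g := fun v => W v x₀) (hW.continuous x₀).aestronglyMeasurable
      (fun z hz => (hδx z (by simpa using hz)).le)
    rw [← hρ, ← h1, hW.zero, one_apply_eq_self, dist_eq_norm] at h2
    exact h2

end IsWeylSystem

/-! ### Commuting tuples have Dirac operators of index zero -/

section index

variable {H : Type*} [NormedAddCommGroup H] [InnerProductSpace ℂ H] [CompleteSpace H]
  {D : Submodule ℂ H} {κ : Type*} [Fintype κ]

/-- The vectors whose graph norm with respect to the tuple `q` is at most `c`. -/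
def graphBall (q : κ → D →ₗ[ℂ] H) (c : ℝ) : Set H :=
  {x | ∃ x' : D, (x' : H) = x ∧ ‖x‖ ≤ c ∧ ∀ α, ‖q α x'‖ ≤ c}

/-- The properties used of a tuple of strongly commuting self-adjoint operators on the intersection
`D` of their domains: they are symmetric, commute as sesquilinear forms, and are jointly closed, and
there are bounded self-adjoint operators `R` close to the identity that map into `D` and commute
with the tuple. -/
structure IsCommutingTuple (q : κ → D →ₗ[ℂ] H) : Prop where
  symm : ∀ α (x y : D), ⟪q α x, (y : H)⟫_ℂ = ⟪(x : H), q α y⟫_ℂ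
  comm : ∀ α β x y, ⟪q α x, q β y⟫_ℂ = ⟪q β x, q α y⟫_ℂ
  closed : ∀ (x : ℕ → D) (a : H) (y : κ → H), Tendsto (fun n => (x n : H)) atTop (𝓝 a) →
    (∀ α, Tendsto (fun n => q α (x n)) atTop (𝓝 (y α))) →
    ∃ a' : D, (a' : H) = a ∧ ∀ α, q α a' = y α
  mollifier : ∀ (x₀ : H) (ε : ℝ), 0 < ε → ∃ (R : H →L[ℂ] H) (hR : ∀ x, R x ∈ D),
    (∀ x y, ⟪R x, y⟫_ℂ = ⟪x, R y⟫_ℂ) ∧ (∀ α (x : D), q α ⟨R x, hR x⟩ = R (q α x)) ∧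
    ‖R x₀ - x₀‖ ≤ ε

namespace IsCommutingTuple

variable {q : κ → D →ₗ[ℂ] H}

omit [CompleteSpace H] [Fintype κ] in
theorem dense (hq : IsCommutingTuple q) : Dense (D : Set H) := by
  rw [Metric.dense_iff]
  intro x r hr
  obtain ⟨R, hR, -, -, h⟩ := hq.mollifier x (r / 2) (half_pos hr)
  refine ⟨R x, ?_, hR x⟩
  rw [Metric.mem_ball, dist_eq_norm]
  linarith

/-- If the graph norm ball is precompact, then joint injectivity is quantitative. -/
theorem exists_norm_sq_le (hq : IsCommutingTuple q)
    (hcpt : ∀ c, TotallyBounded (graphBall q c)) (hinj : ∀ x, (∀ α, q α x = 0) → x = 0) :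
    ∃ c : ℝ, 0 < c ∧ ∀ x : D, ‖(x : H)‖ ^ 2 ≤ c * ∑ α, ‖q α x‖ ^ 2 := by
  by_contra! hcon
  have h1 : ∀ n : ℕ, ∃ x : D, ‖(x : H)‖ = 1 ∧ ∑ α, ‖q α x‖ ^ 2 < 1 / ((n : ℝ) + 1) := by
    intro n
    obtain ⟨x, hx⟩ := hcon ((n : ℝ) + 1) (by positivity)
    have hx0 : 0 < ‖(x : H)‖ := by
      by_contra h
      have h0 : ‖(x : H)‖ = 0 := le_antisymm (not_lt.1 h) (norm_nonneg _)
      rw [h0, zero_pow two_ne_zero] at hx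
      exact absurd hx (not_lt.2 (by positivity))
    refine ⟨((‖(x : H)‖⁻¹ : ℝ) : ℂ) • x, ?_, ?_⟩
    · rw [Submodule.coe_smul, norm_smul, Complex.norm_real, norm_inv, norm_norm,
        inv_mul_cancel₀ hx0.ne']
    · simp only [map_smul, norm_smul, mul_pow, Complex.norm_real, norm_inv, norm_norm]
      rw [← Finset.mul_sum, lt_div_iff₀ (by positivity), inv_pow, mul_assoc, inv_mul_lt_iff₀
        (by positivity), mul_one, mul_comm]
      exact hx
  choose x hx1 hx2 using h1
  have hq1 : ∀ n α, ‖q α (x n)‖ ^ 2 < 1 / ((n : ℝ) + 1) := fun n α =>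
    lt_of_le_of_lt (Finset.single_le_sum (f := fun α => ‖q α (x n)‖ ^ 2)
      (fun _ _ => sq_nonneg _) (Finset.mem_univ α)) (hx2 n)
  have hmem : ∀ n, (x n : H) ∈ closure (graphBall q 1) := by
    intro n
    refine subset_closure ⟨x n, rfl, (hx1 n).le, fun α => ?_⟩
    have h2 : (1 : ℝ) / ((n : ℝ) + 1) ≤ 1 := by
      rw [div_le_one (by positivity)]
      linarith [(Nat.cast_nonneg n : (0 : ℝ) ≤ n)]
    nlinarith [hq1 n α, norm_nonneg (q α (x n))]
  have hK : IsCompact (closure (graphBall q 1)) :=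
    (hcpt 1).closure.isCompact_of_isClosed isClosed_closure
  obtain ⟨a, -, φ, hφ, ha⟩ := hK.tendsto_subseq hmem
  have hlim : ∀ α, Tendsto (fun n => q α (x (φ n))) atTop (𝓝 0) := by
    intro α
    rw [tendsto_zero_iff_norm_tendsto_zero]
    have h3 : Tendsto (fun n => ‖q α (x n)‖ ^ 2) atTop (𝓝 0) :=
      squeeze_zero (fun n => sq_nonneg _) (fun n => (hq1 n α).le)
        tendsto_one_div_add_atTop_nhds_zero_nat
    have h4 := (h3.comp hφ.tendsto_atTop).sqrt
    simpa [Function.comp_def] using h4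
  obtain ⟨a', ha', hqa⟩ := hq.closed (fun n => x (φ n)) a 0 ha hlim
  have h5 : ‖a‖ = 1 := by
    refine tendsto_nhds_unique ha.norm ?_
    simp [hx1]
  rw [← ha', hinj a' hqa] at h5
  simp at h5

variable {ι : Type*} [Fintype ι] [DecidableEq ι] [DecidableEq κ] {C : κ → Matrix ι ι ℂ}

omit [CompleteSpace H] in
/-- For a commuting tuple the Dirac operator controls the graph norm. -/
theorem norm_le_norm_diracMap (hq : IsCommutingTuple q)
    (hC : ∀ α β, (C α)ᴴ * C β + (C β)ᴴ * C α = if α = β then 2 else 0) (ψ : ι → D) (α : κ) (i : ι) :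
    ‖q α (ψ i)‖ ≤ ‖diracMap C q ψ‖ := by
  refine (sq_le_sq₀ (norm_nonneg _) (norm_nonneg _)).1 ?_
  rw [norm_sq_diracMap hC hq.comm]
  exact (Finset.single_le_sum (f := fun i => ‖q α (ψ i)‖ ^ 2)
      (fun _ _ => sq_nonneg _) (Finset.mem_univ i)).trans
    (Finset.single_le_sum (f := fun α => ∑ i, ‖q α (ψ i)‖ ^ 2)
      (fun _ _ => Finset.sum_nonneg fun _ _ => sq_nonneg _) (Finset.mem_univ α))

omit [CompleteSpace H] in
theorem sum_norm_sq_le (hq : IsCommutingTuple q)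
    (hC : ∀ α β, (C α)ᴴ * C β + (C β)ᴴ * C α = if α = β then 2 else 0) {c : ℝ}
    (hc : ∀ x : D, ‖(x : H)‖ ^ 2 ≤ c * ∑ α, ‖q α x‖ ^ 2) (ψ : ι → D) :
    ∑ i, ‖(ψ i : H)‖ ^ 2 ≤ c * ‖diracMap C q ψ‖ ^ 2 := by
  rw [norm_sq_diracMap hC hq.comm, Finset.sum_comm, Finset.mul_sum]
  exact Finset.sum_le_sum fun i _ => hc (ψ i)

theorem isClosed_range_diracMap (hq : IsCommutingTuple q)
    (hC : ∀ α β, (C α)ᴴ * C β + (C β)ᴴ * C α = if α = β then 2 else 0) {c : ℝ} (hc0 : 0 < c)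
    (hc : ∀ x : D, ‖(x : H)‖ ^ 2 ≤ c * ∑ α, ‖q α x‖ ^ 2) :
    IsClosed (LinearMap.range (diracMap C q) : Set (PiLp 2 fun _ : ι => H)) := by
  refine IsSeqClosed.isClosed fun y a hy hya => ?_
  choose ψ hψ using hy
  have hcau := Metric.cauchySeq_iff.1 hya.cauchySeq
  have hq' : ∀ α i, CauchySeq fun n => q α (ψ n i) := by
    intro α i
    rw [Metric.cauchySeq_iff]
    intro ε hε
    obtain ⟨N, hN⟩ := hcau ε hε
    refine ⟨N, fun m hm n hn => lt_of_le_of_lt ?_ (hN m hm n hn)⟩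
    rw [dist_eq_norm, dist_eq_norm, ← map_sub, ← hψ m, ← hψ n, ← map_sub]
    exact hq.norm_le_norm_diracMap hC (ψ m - ψ n) α i
  have hx : ∀ i, CauchySeq fun n => (ψ n i : H) := by
    intro i
    rw [Metric.cauchySeq_iff]
    intro ε hε
    obtain ⟨N, hN⟩ := hcau (ε / Real.sqrt c) (by positivity)
    refine ⟨N, fun m hm n hn => ?_⟩
    have h1 := hN m hm n hn
    rw [dist_eq_norm, ← hψ m, ← hψ n, ← map_sub, lt_div_iff₀ (by positivity)] at h1
    rw [dist_eq_norm, ← Submodule.coe_sub]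
    have h2 := hq.sum_norm_sq_le hC hc (ψ m - ψ n)
    have h3 := Finset.single_le_sum (f := fun i => ‖((ψ m - ψ n) i : H)‖ ^ 2)
      (fun _ _ => sq_nonneg _) (Finset.mem_univ i)
    refine lt_of_le_of_lt ?_ h1
    refine (sq_le_sq₀ (norm_nonneg _) (by positivity)).1 ?_
    rw [mul_pow, Real.sq_sqrt hc0.le, mul_comm]
    exact h3.trans h2
  choose b hb using fun α => fun i => cauchySeq_tendsto_of_complete (hq' α i)
  choose ξ hξ using fun i => cauchySeq_tendsto_of_complete (hx i)
  choose ξ' hξ' hqξ using fun i => hq.closed (fun n => ψ n i) (ξ i) (fun α => b α i) (hξ i)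
    (fun α => hb α i)
  refine ⟨ξ', ?_⟩
  ext i
  have h4 : Tendsto (fun n => y n i) atTop (𝓝 (a i)) :=
    ((PiLp.continuous_apply 2 _ i).tendsto a).comp hya
  refine tendsto_nhds_unique ?_ h4
  simp only [← hψ, diracMap_apply, hqξ]
  exact tendsto_finsetSum _ fun α _ => tendsto_finsetSum _ fun j _ => (hb α j).const_smul _

omit [CompleteSpace H] in
/-- A vector orthogonal to the range becomes, after mollification, a zero mode of the adjoint Dirac
operator, and the latter is injective too. -/
theorem eq_zero_of_orthogonal_range_diracMap (hq : IsCommutingTuple q)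
    (hC' : ∀ α β, C α * (C β)ᴴ + C β * (C α)ᴴ = if α = β then 2 else 0)
    (hinj : ∀ x, (∀ α, q α x = 0) → x = 0) {ξ : PiLp 2 fun _ : ι => H}
    (hξ : ∀ φ, ⟪diracMap C q φ, ξ⟫_ℂ = 0) : ξ = 0 := by
  ext i
  rw [PiLp.zero_apply, ← norm_le_zero_iff]
  refine le_of_forall_pos_le_add fun ε hε => ?_
  obtain ⟨R, hR, hRs, hRq, hRε⟩ := hq.mollifier (ξ i) ε hε
  set ψ : ι → D := fun k => ⟨R (ξ k), hR _⟩ with hψ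
  have h1 : diracMap (fun α => (C α)ᴴ) q ψ = 0 := by
    ext j
    rw [PiLp.zero_apply]
    refine hq.dense.eq_zero_of_inner_left (𝕜 := ℂ) fun v hv => ?_
    have h2 := hξ (Pi.single j ⟨R v, hR v⟩)
    have h3 : ∀ i, diracMap C q (Pi.single j ⟨R v, hR v⟩) i =
        ∑ α, C α i j • R (q α ⟨v, hv⟩) := by
      intro i
      rw [diracMap_apply]
      refine Finset.sum_congr rfl fun α _ => ?_
      rw [Finset.sum_eq_single j (by intro k _ hk; simp [hk]) (by simp), Pi.single_eq_same,
        ← hRq]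
    rw [PiLp.inner_apply] at h2
    simp only [h3, sum_inner, inner_smul_left, hRs] at h2
    rw [diracMap_apply, ← inner_conj_symm]
    rw [map_eq_zero]
    simp only [inner_sum, inner_smul_right]
    rw [Finset.sum_comm]
    rw [← h2]
    refine Finset.sum_congr rfl fun k _ => Finset.sum_congr rfl fun α _ => ?_
    rw [Matrix.conjTranspose_apply, RCLike.star_def]
    congr 1
    exact (hq.symm α ⟨v, hv⟩ (ψ k)).symm
  have h4 : ψ i = 0 := by
    refine hinj _ fun α => ?_
    have h5 := hq.norm_le_norm_diracMap (C := fun α => (C α)ᴴ)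
      (fun α β => by simpa using hC' α β) ψ α i
    rw [h1, norm_zero] at h5
    exact norm_le_zero_iff.1 h5
  have h6 : R (ξ i) = 0 := congrArg Subtype.val h4
  rw [h6, zero_sub, norm_neg] at hRε
  simpa using hRε

theorem bijective_diracMap (hq : IsCommutingTuple q)
    (hC : ∀ α β, (C α)ᴴ * C β + (C β)ᴴ * C α = if α = β then 2 else 0)
    (hC' : ∀ α β, C α * (C β)ᴴ + C β * (C α)ᴴ = if α = β then 2 else 0)
    (hcpt : ∀ c, TotallyBounded (graphBall q c)) (hinj : ∀ x, (∀ α, q α x = 0) → x = 0) :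
    Function.Bijective (diracMap C q) := by
  obtain ⟨c, hc0, hc⟩ := hq.exists_norm_sq_le hcpt hinj
  constructor
  · rw [← LinearMap.ker_eq_bot, LinearMap.ker_eq_bot']
    intro ψ hψ
    funext i
    refine hinj _ fun α => ?_
    have := hq.norm_le_norm_diracMap hC ψ α i
    rw [hψ, norm_zero] at this
    exact norm_le_zero_iff.1 this
  · rw [← LinearMap.range_eq_top]
    have h1 := hq.isClosed_range_diracMap hC hc0 hc
    rw [← h1.submodule_topologicalClosure_eq, Submodule.topologicalClosure_eq_top_iff,
      Submodule.eq_bot_iff]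
    intro ξ hξ
    exact hq.eq_zero_of_orthogonal_range_diracMap hC' hinj fun φ => hξ _ ⟨φ, rfl⟩

/-- The Dirac operator of a jointly injective commuting tuple with precompact graph balls has a
compact inverse. -/
theorem exists_compact_inverse (hq : IsCommutingTuple q)
    (hC : ∀ α β, (C α)ᴴ * C β + (C β)ᴴ * C α = if α = β then 2 else 0)
    (hC' : ∀ α β, C α * (C β)ᴴ + C β * (C α)ᴴ = if α = β then 2 else 0)
    (hcpt : ∀ c, TotallyBounded (graphBall q c)) (hinj : ∀ x, (∀ α, q α x = 0) → x = 0) :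
    ∃ G : (PiLp 2 fun _ : ι => H) →L[ℂ] (PiLp 2 fun _ : ι => H), IsCompactOperator G ∧
      ∀ y, ∃ ψ : ι → D, (∀ i, G y i = ψ i) ∧ diracMap C q ψ = y := by
  obtain ⟨c, hc0, hc⟩ := hq.exists_norm_sq_le hcpt hinj
  let E := LinearEquiv.ofBijective (diracMap C q) (hq.bijective_diracMap hC hC' hcpt hinj)
  have hE : ∀ y, diracMap C q (E.symm y) = y := fun y => E.apply_symm_apply y
  let G₀ : (PiLp 2 fun _ : ι => H) →ₗ[ℂ] (PiLp 2 fun _ : ι => H) :=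
    { toFun := fun y => WithLp.toLp 2 fun i => (E.symm y i : H)
      map_add' := fun y z => by ext i; simp
      map_smul' := fun r y => by ext i; simp }
  have hG₀ : ∀ y i, G₀ y i = (E.symm y i : H) := fun y i => rfl
  have hbound : ∀ y, ‖G₀ y‖ ≤ Real.sqrt c * ‖y‖ := by
    intro y
    refine (sq_le_sq₀ (norm_nonneg _) (by positivity)).1 ?_
    rw [PiLp.norm_sq_eq_of_L2, mul_pow, Real.sq_sqrt hc0.le]
    have := hq.sum_norm_sq_le hC hc (E.symm y)
    rwa [hE] at this
  refine ⟨G₀.mkContinuous _ hbound, ?_, fun y => ⟨E.symm y, fun i => rfl, hE y⟩⟩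
  set K := closure (graphBall q (max (Real.sqrt c) 1)) with hK
  have hKc : IsCompact K :=
    (hcpt _).closure.isCompact_of_isClosed isClosed_closure
  refine ⟨(fun f : ι → H => WithLp.toLp 2 f) '' Set.univ.pi fun _ => K,
    (isCompact_univ_pi fun _ => hKc).image (PiLp.continuous_toLp 2 _), ?_⟩
  refine Filter.mem_of_superset (Metric.closedBall_mem_nhds 0 one_pos) fun y hy => ?_
  rw [mem_closedBall_zero_iff] at hy
  refine ⟨fun i => (E.symm y i : H),
    fun i _ => subset_closure ⟨E.symm y i, rfl, ?_, fun α => ?_⟩, rfl⟩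
  · refine le_trans ?_ (le_max_left _ _)
    calc ‖(E.symm y i : H)‖ = ‖G₀ y i‖ := rfl
      _ ≤ ‖G₀ y‖ := PiLp.norm_apply_le _ _
      _ ≤ Real.sqrt c * ‖y‖ := hbound y
      _ ≤ Real.sqrt c := mul_le_of_le_one_right (Real.sqrt_nonneg _) hy
  · refine le_trans ?_ (le_max_right _ _)
    have := hq.norm_le_norm_diracMap hC (E.symm y) α i
    rw [hE] at this
    exact this.trans hy

end IsCommutingTuple

/-- A bounded operator on a dense subspace extends. -/
theorem exists_extension {D : Submodule ℂ H} (hD : Dense (D : Set H)) (A : D →ₗ[ℂ] H) {c : ℝ}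
    (hA : ∀ x, ‖A x‖ ≤ c * ‖(x : H)‖) : ∃ B : H →L[ℂ] H, ∀ x : D, B x = A x := by
  refine ⟨(A.mkContinuous c hA).extend D.subtypeL, fun x => ?_⟩
  exact ContinuousLinearMap.extend_eq _ (hD.denseRange_val)
    isUniformEmbedding_subtype_val.isUniformInducing x

variable {ι : Type*} [Fintype ι] [DecidableEq ι] [DecidableEq κ] {C : κ → Matrix ι ι ℂ}

/-- A bounded perturbation of a jointly injective commuting tuple with precompact graph balls has a
Dirac operator of index zero, so that injectivity implies surjectivity. With `T` and `T'` the Dirac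
operators of `q` and `q'`, this is the Fredholm alternative for `T T'⁻¹ = 1 + (T - T') T'⁻¹`. -/
theorem surjective_diracMap_of_bounded_sub {q q' : κ → D →ₗ[ℂ] H} (hq' : IsCommutingTuple q')
    (hC : ∀ α β, (C α)ᴴ * C β + (C β)ᴴ * C α = if α = β then 2 else 0)
    (hC' : ∀ α β, C α * (C β)ᴴ + C β * (C α)ᴴ = if α = β then 2 else 0)
    (hcpt : ∀ c, TotallyBounded (graphBall q' c)) (hinj' : ∀ x, (∀ α, q' α x = 0) → x = 0)
    (hbdd : ∀ α, ∃ c : ℝ, ∀ x, ‖q α x - q' α x‖ ≤ c * ‖(x : H)‖)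
    (hinj : ∀ ψ, diracMap C q ψ = 0 → ψ = 0) : Function.Surjective (diracMap C q) := by
  obtain ⟨G, hG, hGψ⟩ := hq'.exists_compact_inverse hC hC' hcpt hinj'
  choose ψ hψ hψy using hGψ
  have hB : ∀ α, ∃ B : H →L[ℂ] H, ∀ x : D, B x = q α x - q' α x := by
    intro α
    obtain ⟨c, hc⟩ := hbdd α
    exact exists_extension hq'.dense (q α - q' α) hc
  choose B hB using hB
  let M : (PiLp 2 fun _ : ι => H) →L[ℂ] (PiLp 2 fun _ : ι => H) :=
    ((PiLp.continuousLinearEquiv 2 ℂ fun _ : ι => H).symm : (ι → H) →L[ℂ] _) ∘L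
      ContinuousLinearMap.pi fun i => ∑ α, ∑ j, C α i j • (B α ∘L PiLp.proj 2 (fun _ : ι => H) j)
  have hM : ∀ y i, M y i = ∑ α, ∑ j, C α i j • B α (y j) := by
    intro y i
    simp [M]
  have hK : IsCompactOperator (M ∘L G : (PiLp 2 fun _ : ι => H) →L[ℂ] _) := hG.clm_comp M
  have hKy : ∀ y, (M ∘L G) y + y = diracMap C q (ψ y) := by
    intro y
    ext i
    have h := congrArg (fun v : PiLp 2 fun _ : ι => H => v i) (hψy y)
    simp only [diracMap_apply] at h
    rw [PiLp.add_apply, ContinuousLinearMap.comp_apply, hM, ← h]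
    simp only [diracMap_apply, hψ, hB, smul_sub, Finset.sum_sub_distrib]
    rw [sub_add_cancel]
  rcases hK.hasEigenvalue_or_mem_resolventSet (μ := -1) (by norm_num) with h | h
  · obtain ⟨v, hv⟩ := h.exists_hasEigenvector
    have h1 : (M ∘L G) v = (-1 : ℂ) • v := hv.apply_eq_smul
    have h2 := hinj (ψ v) (by rw [← hKy, h1]; simp)
    have h3 := hψy v
    rw [h2, map_zero] at h3
    exact absurd h3.symm hv.2
  · intro y
    rw [spectrum.mem_resolventSet_iff] at h
    obtain ⟨S, hS⟩ := h
    refine ⟨ψ (-((S⁻¹ : _ˣ) : (PiLp 2 fun _ : ι => H) →L[ℂ] _) y), ?_⟩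
    rw [← hKy]
    have h1 : (S : (PiLp 2 fun _ : ι => H) →L[ℂ] _)
        (((S⁻¹ : _ˣ) : (PiLp 2 fun _ : ι => H) →L[ℂ] _) y) = y := by
      rw [← mul_apply_eq_comp, Units.mul_inv, one_apply_eq_self]
    rw [hS] at h1
    simp only [map_neg]
    simpa [sub_eq_add_neg, add_comm] using! h1

end index

/-! ### Operations on commuting tuples -/

section tuples

variable {H : Type*} [NormedAddCommGroup H] [InnerProductSpace ℂ H]
  {D : Submodule ℂ H} {κ : Type*} [Fintype κ] {q : κ → D →ₗ[ℂ] H}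

omit [Fintype κ] in
theorem IsCommutingTuple.sub_const (hq : IsCommutingTuple q) (t : ℝ) :
    IsCommutingTuple fun α => q α - t • D.subtype where
  symm α x y := by
    simp only [LinearMap.sub_apply, LinearMap.smul_apply, Submodule.subtype_apply,
      ← Complex.coe_smul, inner_sub_left, inner_sub_right, inner_smul_left, inner_smul_right,
      Complex.conj_ofReal, hq.symm]
  comm α β x y := by
    simp only [LinearMap.sub_apply, LinearMap.smul_apply, Submodule.subtype_apply,
      ← Complex.coe_smul, inner_sub_left, inner_sub_right, inner_smul_left, inner_smul_right,
      Complex.conj_ofReal, hq.symm, hq.comm α β]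
    ring
  closed x a y hx hy := by
    obtain ⟨a', ha', h⟩ := hq.closed x a (fun α => y α + t • a) hx (fun α => by
      simpa using (hy α).add (hx.const_smul t))
    exact ⟨a', ha', fun α => by simp [h, ha']⟩
  mollifier x₀ ε hε := by
    obtain ⟨R, hR, hRs, hRq, hRε⟩ := hq.mollifier x₀ ε hε
    refine ⟨R, hR, hRs, fun α x => ?_, hRε⟩
    simp only [LinearMap.sub_apply, LinearMap.smul_apply, Submodule.subtype_apply, map_sub, hRq]
    rw [← Complex.coe_smul, ← Complex.coe_smul, map_smul]

/-- An invertible real linear change of a commuting tuple is again one; `b` is a left inverse of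
the coefficient matrix `e`. -/
theorem IsCommutingTuple.linear_change (hq : IsCommutingTuple q) {κ' : Type*} [Fintype κ']
    (e : κ' → κ → ℝ) (b : κ → κ' → ℝ) (hb : ∀ j, q j = ∑ α, b j α • ∑ k, e α k • q k) :
    IsCommutingTuple fun α => ∑ j, e α j • q j where
  symm α x y := by
    simp only [LinearMap.sum_apply, LinearMap.smul_apply, ← Complex.coe_smul, sum_inner, inner_sum,
      inner_smul_left, inner_smul_right, Complex.conj_ofReal, hq.symm]
  comm α β x y := by
    simp only [LinearMap.sum_apply, LinearMap.smul_apply, ← Complex.coe_smul, sum_inner, inner_sum,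
      inner_smul_left, inner_smul_right, Complex.conj_ofReal]
    simp only [Finset.mul_sum]
    rw [Finset.sum_comm]
    refine Finset.sum_congr rfl fun j _ => Finset.sum_congr rfl fun k _ => ?_
    rw [hq.comm]
    ring
  closed x a y hx hy := by
    have h1 : ∀ j, Tendsto (fun n => q j (x n)) atTop (𝓝 (∑ α, b j α • y α)) := by
      intro j
      rw [hb j]
      simp only [LinearMap.sum_apply _ _ (x _), LinearMap.smul_apply _ _ (x _)]
      refine tendsto_finsetSum _ fun α _ => ?_
      simpa only [LinearMap.sum_apply, LinearMap.smul_apply] using (hy α).const_smul (b j α)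
    obtain ⟨a', ha', h⟩ := hq.closed x a _ hx h1
    refine ⟨a', ha', fun α => tendsto_nhds_unique ?_ (hy α)⟩
    simp only [LinearMap.sum_apply, LinearMap.smul_apply, h]
    exact tendsto_finsetSum _ fun j _ => (h1 j).const_smul (e α j)
  mollifier x₀ ε hε := by
    obtain ⟨R, hR, hRs, hRq, hRε⟩ := hq.mollifier x₀ ε hε
    refine ⟨R, hR, hRs, fun α x => ?_, hRε⟩
    simp only [LinearMap.sum_apply, LinearMap.smul_apply, map_sum, hRq]
    refine Finset.sum_congr rfl fun j _ => ?_
    rw [← Complex.coe_smul, ← Complex.coe_smul, map_smul]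

omit [Fintype κ] in
/-- Joint eigenvectors for distinct joint eigenvalues are orthogonal, so precompactness of the graph
balls leaves room for a point of the diagonal outside of the joint point spectrum. -/
theorem IsCommutingTuple.exists_not_joint_eigenvalue [CompleteSpace H] [Nonempty κ]
    (hq : IsCommutingTuple q)
    (hcpt : ∀ c, TotallyBounded (graphBall q c)) :
    ∃ t : ℝ, ∀ x : D, (∀ α, (q α - t • D.subtype) x = 0) → x = 0 := by
  by_contra! hcon
  have h1 : ∀ n : ℕ, ∃ x : D, ‖(x : H)‖ = 1 ∧
      ∀ α, q α x = ((1 / ((n : ℝ) + 1) : ℝ) : ℂ) • (x : H) := by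
    intro n
    obtain ⟨x, hx, hx0⟩ := hcon (1 / ((n : ℝ) + 1))
    have hx0' : ‖(x : H)‖ ≠ 0 := by simpa using hx0
    refine ⟨((‖(x : H)‖⁻¹ : ℝ) : ℂ) • x, ?_, fun α => ?_⟩
    · rw [Submodule.coe_smul, norm_smul, Complex.norm_real, norm_inv, norm_norm,
        inv_mul_cancel₀ hx0']
    · have h := hx α
      simp only [LinearMap.sub_apply, LinearMap.smul_apply, Submodule.subtype_apply, sub_eq_zero]
        at h
      rw [map_smul, h, ← Complex.coe_smul, Submodule.coe_smul, smul_comm]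
  choose x hx1 hx2 using h1
  have horth : ∀ m n, m ≠ n → ⟪(x m : H), x n⟫_ℂ = 0 := by
    intro m n hmn
    obtain ⟨α⟩ := ‹Nonempty κ›
    have h := hq.symm α (x m) (x n)
    rw [hx2, hx2, inner_smul_left, inner_smul_right, Complex.conj_ofReal, ← sub_eq_zero,
      ← sub_mul, mul_eq_zero] at h
    refine h.resolve_left fun h0 => hmn ?_
    rw [sub_eq_zero] at h0
    have h0 : (1 : ℝ) / ((m : ℝ) + 1) = 1 / ((n : ℝ) + 1) := by exact_mod_cast h0
    rw [div_eq_div_iff (by positivity) (by positivity), one_mul, one_mul, add_left_inj] at h0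
    exact_mod_cast h0.symm
  have hmem : ∀ n, (x n : H) ∈ closure (graphBall q 1) := by
    intro n
    refine subset_closure ⟨x n, rfl, (hx1 n).le, fun α => ?_⟩
    rw [hx2, norm_smul, hx1, mul_one, Complex.norm_real, Real.norm_of_nonneg (by positivity),
      div_le_one (by positivity)]
    linarith [(Nat.cast_nonneg n : (0 : ℝ) ≤ n)]
  obtain ⟨a, -, φ, hφ, ha⟩ :=
    ((hcpt 1).closure.isCompact_of_isClosed isClosed_closure).tendsto_subseq hmem
  obtain ⟨N, hN⟩ := Metric.cauchySeq_iff.1 ha.cauchySeq 1 one_pos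
  have h2 := hN (N + 1) (by omega) N le_rfl
  have h3 : ‖(x (φ (N + 1)) : H) - x (φ N)‖ ^ 2 = 2 := by
    rw [@norm_sub_sq ℂ, horth _ _ (hφ.injective.ne (by omega)), hx1, hx1]
    norm_num
  simp only [Function.comp_apply, dist_eq_norm] at h2
  nlinarith [norm_nonneg ((x (φ (N + 1)) : H) - x (φ N))]

end tuples

/-! ### From representations to Weyl systems and commuting tuples -/

section representations

variable {H : Type*} [NormedAddCommGroup H] [InnerProductSpace ℂ H] [CompleteSpace H] {d : ℕ}
  {θ : Matrix (Fin d) (Fin d) ℝ} {P : Fin d → H →ₗ.[ℂ] H}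

theorem IsHeisenbergRep.exists_isWeylSystem (hP : IsHeisenbergRep θ P) (hθ : θ.transpose = -θ) :
    ∃ W : (Fin d → ℝ) → H →L[ℂ] H, IsWeylSystem (Matrix.toLinearMap₂' ℝ θ) W ∧
      (∀ j, IsUnitaryGroupOf (P j) fun s => W (Pi.single j s)) ∧
      ∀ j x y, (x, y) ∈ (P j).graph ↔ HasGenerator W (Pi.single j 1) x y := by
  obtain ⟨-, U, hU, hcomm⟩ := hP
  obtain ⟨W, hW, hWU⟩ := Weyl.exists_isWeylSystem hθ hU hcomm
  refine ⟨W, hW, fun j => by simpa only [hWU] using hU j, fun j x y => ?_⟩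
  rw [(hU j).generator, HasGenerator]
  simp only [← Pi.single_smul, smul_eq_mul, mul_one, hWU]

theorem isAlt_toLinearMap₂' (hθ : θ.transpose = -θ) :
    (Matrix.toLinearMap₂' ℝ θ : (Fin d → ℝ) →ₗ[ℝ] (Fin d → ℝ) →ₗ[ℝ] ℝ).IsAlt := by
  intro x
  have h : x ⬝ᵥ θ *ᵥ x = -(x ⬝ᵥ θ *ᵥ x) := by
    conv_lhs => rw [Matrix.dotProduct_mulVec, ← Matrix.mulVec_transpose, hθ, dotProduct_comm,
      Matrix.neg_mulVec, dotProduct_neg]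
  rw [Matrix.toLinearMap₂'_apply']
  linarith

/-- Strong commutation is the case `θ = 0` of the Heisenberg relations. -/
theorem IsStronglyCommuting.isHeisenbergRep (hP : IsStronglyCommuting P) :
    IsHeisenbergRep 0 P := by
  obtain ⟨h, U, hU, hcomm⟩ := hP
  exact ⟨h, U, hU, fun j k s t => by simpa using hcomm j k s t⟩

theorem hasGenerator_of_single {W : (Fin d → ℝ) → H →L[ℂ] H}
    (hW : IsWeylSystem (Matrix.toLinearMap₂' ℝ θ) W) {x : H} {y : Fin d → H}
    (h : ∀ j, HasGenerator W (Pi.single j 1) x (y j)) (z : Fin d → ℝ) :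
    HasGenerator W z x (∑ j, z j • y j) := by
  have h1 := hW.hasGenerator_sum Finset.univ fun j => (h j).smul (z j)
  rwa [← show z = ∑ j, z j • Pi.single j (1 : ℝ) by ext k; simp [Pi.single_apply]] at h1

/-- The restrictions `p` of strongly commuting self-adjoint operators to their common domain `D`. -/
theorem isCommutingTuple_of_isStronglyCommuting (hP : IsStronglyCommuting P) {D : Submodule ℂ H}
    {p : Fin d → D →ₗ[ℂ] H}
    (hD : ∀ x, (∀ j, x ∈ (P j).domain) → x ∈ D)
    (hpD : ∀ j (x : D), ((x : H), p j x) ∈ (P j).graph) : IsCommutingTuple p := by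
  obtain ⟨W, hW, -, hWP⟩ := hP.isHeisenbergRep.exists_isWeylSystem (by simp)
  have halt := isAlt_toLinearMap₂' (d := d) (θ := 0) (by simp)
  have hgen : ∀ j (x : D), HasGenerator W (Pi.single j 1) x (p j x) := fun j x =>
    (hWP j _ _).1 (hpD j x)
  have huniq : ∀ j (x : D) (x' y : H), x' = x → (x', y) ∈ (P j).graph → p j x = y := by
    rintro j x _ y rfl hy
    have h1 := (hgen j x).unique ((hWP j _ _).1 hy)
    exact smul_right_injective _ Complex.I_ne_zero h1
  refine ⟨fun j x y => hW.inner_generator_left halt (hgen j x) (hgen j y), fun j k x y => ?_,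
    fun x a y hx hy => ?_, fun x₀ ε hε => ?_⟩
  · have := hW.inner_generator_sub halt (hgen j x) (hgen k x) (hgen j y) (hgen k y)
    simpa [sub_eq_zero] using this
  · have h1 : ∀ j, (a, y j) ∈ (P j).graph := fun j =>
      (hP.1 j).isClosed.mem_of_tendsto (hx.prodMk_nhds (hy j))
        (Eventually.of_forall fun n => hpD j (x n))
    exact ⟨⟨a, hD a fun j => LinearPMap.mem_domain_of_mem_graph (h1 j)⟩, rfl,
      fun j => huniq j _ a _ rfl (h1 j)⟩
  · rw [map_zero] at hW
    obtain ⟨R, hRs, hRW, hRd, hRε⟩ := hW.exists_mollifier x₀ hε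
    have hRD : ∀ x, R x ∈ D := fun x => hD _ fun j => by
      obtain ⟨y, hy⟩ := hRd (Pi.single j 1) x
      exact LinearPMap.mem_domain_of_mem_graph ((hWP j _ _).2 hy)
    refine ⟨R, hRD, hRs, fun j x => huniq j _ (R x) _ rfl ((hWP j _ _).2 ?_), hRε⟩
    have h1 := (R.restrictScalars ℝ).hasFDerivAt.comp_hasDerivAt (0 : ℝ) (hgen j x)
    simpa [HasGenerator, hRW, Function.comp_def] using! h1

end representations

/-! ### Compactness of the common domain -/

section symplectic

variable {H : Type*} [NormedAddCommGroup H] [InnerProductSpace ℂ H] [CompleteSpace H] {d n : ℕ}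
  {θ : Matrix (Fin d) (Fin d) ℝ}

/-- The complex structure `(x, y) ↦ (y, -x)` on `ℝⁿ × ℝⁿ`; it corresponds to the symplectic form
with matrix `Matrix.J`. -/
noncomputable def complexStructure (n : ℕ) :
    EuclideanSpace ℝ (Fin n ⊕ Fin n) →ₗ[ℝ] EuclideanSpace ℝ (Fin n ⊕ Fin n) where
  toFun v := WithLp.toLp 2 (Sum.elim (fun a => v (.inr a)) fun a => -v (.inl a))
  map_add' v w := by ext (a | a) <;> simp [add_comm]
  map_smul' c v := by ext (a | a) <;> simp

theorem complexStructure_complexStructure (v : EuclideanSpace ℝ (Fin n ⊕ Fin n)) :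
    complexStructure n (complexStructure n v) = -v := by
  ext (a | a) <;> simp [complexStructure]

theorem complexStructure_single_inr (a : Fin n) :
    complexStructure n (EuclideanSpace.single (.inr a) 1) = EuclideanSpace.single (.inl a) 1 := by
  ext (b | b) <;> simp [complexStructure]

/-- The linear map with `coordinates e (single α 1) = e α`. -/
noncomputable def coordinates (e : Fin n ⊕ Fin n → Fin d → ℝ) :
    EuclideanSpace ℝ (Fin n ⊕ Fin n) →ₗ[ℝ] (Fin d → ℝ) where
  toFun v := ∑ α, v α • e α
  map_add' v w := by simp [add_smul, Finset.sum_add_distrib]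
  map_smul' c v := by simp [Finset.smul_sum, mul_smul]

theorem coordinates_apply (e : Fin n ⊕ Fin n → Fin d → ℝ) (v : EuclideanSpace ℝ (Fin n ⊕ Fin n)) :
    coordinates e v = ∑ α, v α • e α := rfl

theorem coordinates_single (e : Fin n ⊕ Fin n → Fin d → ℝ) (α : Fin n ⊕ Fin n) :
    coordinates e (EuclideanSpace.single α 1) = e α := by
  rw [coordinates_apply, Finset.sum_eq_single α (by intro β _ h; simp [h]) (by simp)]
  simp

theorem compl₁₂_coordinates {e : Fin n ⊕ Fin n → Fin d → ℝ}
    (he : ∀ α β, Matrix.toLinearMap₂' ℝ θ (e α) (e β) = Matrix.J (Fin n) ℝ α β)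
    (v w : EuclideanSpace ℝ (Fin n ⊕ Fin n)) :
    (Matrix.toLinearMap₂' ℝ θ).compl₁₂ (coordinates e) (coordinates e) v w =
      ⟪complexStructure n v, w⟫_ℝ := by
  have h1 : (Matrix.toLinearMap₂' ℝ θ).compl₁₂ (coordinates e) (coordinates e) v w =
      ∑ α, ∑ β, v α * (w β * Matrix.J (Fin n) ℝ α β) := by
    rw [LinearMap.compl₁₂_apply, coordinates_apply, coordinates_apply, LinearMap.map_sum₂]
    refine Finset.sum_congr rfl fun α _ => ?_
    rw [LinearMap.map_smul₂, map_sum, smul_eq_mul, Finset.mul_sum]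
    refine Finset.sum_congr rfl fun β _ => ?_
    rw [map_smul, he, smul_eq_mul]
  rw [h1, PiLp.inner_apply]
  simp only [Fintype.sum_sum_type, Matrix.J, Matrix.fromBlocks_apply₁₁, Matrix.fromBlocks_apply₁₂,
    Matrix.fromBlocks_apply₂₁, Matrix.fromBlocks_apply₂₂, Matrix.zero_apply, Matrix.neg_apply,
    Matrix.one_apply, complexStructure, LinearMap.coe_mk, AddHom.coe_mk, Sum.elim_inl, Sum.elim_inr,
    mul_zero, Finset.sum_const_zero, zero_add, add_zero, mul_neg, mul_ite, mul_one,
    Finset.sum_neg_distrib, Finset.sum_ite_eq, Finset.mem_univ, if_true, RCLike.inner_apply,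
    conj_trivial]
  rw [add_comm]
  simp only [mul_comm (w _)]

/-- The vectors in the common domain of the tuple `P` whose graph norm is at most `c`, described by
the graphs of the operators. -/
def operatorBall (P : Fin d → H →ₗ.[ℂ] H) (c : ℝ) : Set H :=
  {x | ‖x‖ ≤ c ∧ ∀ j, ∃ y, (x, y) ∈ (P j).graph ∧ ‖y‖ ≤ c}

/-- The common domain of an irreducible representation embeds compactly into the Hilbert space. -/
theorem IsHeisenbergRep.totallyBounded_operatorBall {P : Fin d → H →ₗ.[ℂ] H}
    (hP : IsHeisenbergRep θ P)
    (hirr : IsIrreducibleTuple P) (hθ : θ.transpose = -θ) {e : Fin n ⊕ Fin n → Fin d → ℝ}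
    (he : ∀ α β, Matrix.toLinearMap₂' ℝ θ (e α) (e β) = Matrix.J (Fin n) ℝ α β)
    (hspan : Submodule.span ℝ (Set.range e) = ⊤) (c : ℝ) : TotallyBounded (operatorBall P c) := by
  obtain ⟨W, hW, hWU, hWP⟩ := hP.exists_isWeylSystem hθ
  obtain ⟨hnt, hirr⟩ := hirr
  have halt := isAlt_toLinearMap₂' hθ
  have hLc : Continuous (coordinates e) := LinearMap.continuous_of_finiteDimensional _
  have hW' := hW.comp (coordinates e) hLc
  have halt' : ((Matrix.toLinearMap₂' ℝ θ).compl₁₂ (coordinates e) (coordinates e)).IsAlt :=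
    fun v => halt _
  have hsurj : ∀ z, ∃ v, coordinates e v = z := by
    intro z
    have hz : z ∈ Submodule.span ℝ (Set.range e) := hspan ▸ Submodule.mem_top
    obtain ⟨v, hv⟩ := (Submodule.mem_span_range_iff_exists_fun ℝ).1 hz
    exact ⟨WithLp.toLp 2 v, hv⟩
  rcases lt_or_ge c 0 with hc | hc
  · have : operatorBall P c = ∅ := by
      ext x
      simp only [operatorBall, Set.mem_ofPred_eq, Set.mem_empty_iff_false, iff_false]
      exact fun h => absurd (norm_nonneg x) (not_le.2 (lt_of_le_of_lt h.1 hc))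
    rw [this]
    exact totallyBounded_empty
  set Lc : EuclideanSpace ℝ (Fin n ⊕ Fin n) →L[ℝ] (Fin d → ℝ) :=
    LinearMap.toContinuousLinearMap (coordinates e) with hLcdef
  refine hW'.totallyBounded_of_norm_apply_sub_le halt' (compl₁₂_coordinates he)
    complexStructure_complexStructure (fun S hSc hS => ?_)
    (S := operatorBall P c) (L := d * ‖Lc‖ * c) ?_ (by positivity) ?_
  · refine hirr S hSc fun j => ⟨_, hWU j, fun s x hx => ?_⟩
    obtain ⟨v, hv⟩ := hsurj (Pi.single j s)
    rw [← hv]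
    exact hS v x hx
  · exact (Metric.isBounded_closedBall (x := (0 : H)) (r := c)).subset fun x hx => by
      simpa using hx.1
  · rintro x ⟨-, hx⟩ z
    choose y hy hyc using hx
    have h1 := hasGenerator_of_single hW (fun j => (hWP j _ _).1 (hy j)) (coordinates e z)
    refine (hW.norm_apply_sub_le halt h1).trans ((norm_sum_le _ _).trans ?_)
    have h2 : ∀ j ∈ Finset.univ, ‖coordinates e z j • y j‖ ≤ ‖Lc‖ * ‖z‖ * c := by
      intro j _
      rw [norm_smul]
      exact mul_le_mul ((norm_le_pi_norm (Lc z) j).trans (Lc.le_opNorm z)) (hyc j) (norm_nonneg _)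
        (by positivity)
    refine (Finset.sum_le_sum h2).trans_eq ?_
    simp
    ring

omit [CompleteSpace H] in
/-- Finitely many copies preserve compactness; this is where finite multiplicity is needed. -/
theorem IsMultipleOf.totallyBounded_operatorBall {K : Type*} [NormedAddCommGroup K]
    [InnerProductSpace ℂ K] [CompleteSpace K] {P : Fin d → H →ₗ.[ℂ] H} {Q : Fin d → K →ₗ.[ℂ] K}
    {M : ℕ} (h : IsMultipleOf P M Q) {c : ℝ} (hQ : TotallyBounded (operatorBall Q c)) :
    TotallyBounded (operatorBall P c) := by
  obtain ⟨T, hT⟩ := h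
  have hK : IsCompact (closure (operatorBall Q c)) :=
    hQ.closure.isCompact_of_isClosed isClosed_closure
  have hK' : IsCompact (T.symm '' ((fun f : Fin M → K => WithLp.toLp 2 f) ''
      Set.univ.pi fun _ => closure (operatorBall Q c))) :=
    ((isCompact_univ_pi fun _ => hK).image (PiLp.continuous_toLp 2 _)).image T.symm.continuous
  refine hK'.totallyBounded.subset ?_
  rintro x ⟨hxc, hx⟩
  refine ⟨T x, ⟨fun m => T x m, fun m _ => subset_closure ⟨?_, fun j => ?_⟩, rfl⟩, by simp⟩
  · exact ((PiLp.norm_apply_le (T x) m).trans_eq (T.norm_map x)).trans hxc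
  · obtain ⟨y, hy, hyc⟩ := hx j
    exact ⟨T y m, (hT j x y).1 hy m,
      ((PiLp.norm_apply_le (T y) m).trans_eq (T.norm_map y)).trans hyc⟩

end symplectic

/-! ### Bounded perturbations -/

section perturbation

variable {H : Type*} [NormedAddCommGroup H] [InnerProductSpace ℂ H] {D : Submodule ℂ H}
  {κ κ' : Type*} [Fintype κ] [Fintype κ']

/-- Precompactness of the graph balls passes to stronger graph norms. -/
theorem totallyBounded_graphBall_of_le {q : κ → D →ₗ[ℂ] H} {q' : κ' → D →ₗ[ℂ] H}
    (h : ∀ j, ∃ c : ℝ, 0 ≤ c ∧ ∀ x : D, ‖q j x‖ ≤ c * (‖(x : H)‖ + ∑ α, ‖q' α x‖))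
    (hcpt : ∀ c, TotallyBounded (graphBall q c)) (c : ℝ) : TotallyBounded (graphBall q' c) := by
  choose b hb0 hb using h
  have hB : 0 ≤ ∑ j, b j := Finset.sum_nonneg fun j _ => hb0 j
  refine (hcpt ((1 + ∑ j, b j) * (c + Fintype.card κ' * c))).subset ?_
  rintro _ ⟨x, rfl, hx, hxq⟩
  have hc : 0 ≤ c := (norm_nonneg _).trans hx
  have hc' : 0 ≤ Fintype.card κ' * c := by positivity
  have h1 : ‖(x : H)‖ + ∑ α, ‖q' α x‖ ≤ c + Fintype.card κ' * c := by
    refine add_le_add hx ((Finset.sum_le_sum fun α _ => hxq α).trans_eq ?_)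
    simp
  refine ⟨x, rfl, by nlinarith, fun j => (hb j x).trans ?_⟩
  have h2 : b j ≤ 1 + ∑ j, b j :=
    (Finset.single_le_sum (fun j _ => hb0 j) (Finset.mem_univ j)).trans (by linarith)
  exact mul_le_mul h2 h1 (add_nonneg (norm_nonneg _) (Finset.sum_nonneg fun _ _ => norm_nonneg _))
    (by linarith)

/-- The tuple `p'` need not be jointly injective, but its translate `r` by a suitable multiple of
the identity is, and the translation is a bounded perturbation too. -/
theorem IsCommutingTuple.surjective_diracMap_of_bounded_sub [CompleteSpace H] [Nonempty κ]
    [DecidableEq κ] [DecidableEq κ'] {ι : Type*} [Fintype ι] [DecidableEq ι]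
    {C : κ' → Matrix ι ι ℂ}
    (hC : ∀ α β, (C α)ᴴ * C β + (C β)ᴴ * C α = if α = β then 2 else 0)
    (hC' : ∀ α β, C α * (C β)ᴴ + C β * (C α)ᴴ = if α = β then 2 else 0)
    {p p' : κ → D →ₗ[ℂ] H} (hp' : IsCommutingTuple p')
    (hcpt : ∀ c, TotallyBounded (graphBall p' c))
    (hbdd : ∀ j, ∃ c : ℝ, ∀ x, ‖p j x - p' j x‖ ≤ c * ‖(x : H)‖)
    {e : κ' → κ → ℝ} (hspan : Submodule.span ℝ (Set.range e) = ⊤)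
    (hinj : ∀ ψ, diracMap C (fun α => ∑ j, e α j • p j) ψ = 0 → ψ = 0) :
    Function.Surjective (diracMap C fun α => ∑ j, e α j • p j) := by
  have hb : ∀ j, ∃ b : κ' → ℝ, ∑ α, b α • e α = Pi.single j 1 := fun j =>
    (Submodule.mem_span_range_iff_exists_fun ℝ).1 (hspan ▸ Submodule.mem_top)
  choose b hb using hb
  obtain ⟨t, ht⟩ := hp'.exists_not_joint_eigenvalue hcpt
  set r : κ → D →ₗ[ℂ] H := fun j => p' j - t • D.subtype with hr
  set q' : κ' → D →ₗ[ℂ] H := fun α => ∑ j, e α j • r j with hq'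
  have hrq : ∀ j, r j = ∑ α, b j α • q' α := by
    intro j
    simp only [hq', Finset.smul_sum, smul_smul]
    rw [Finset.sum_comm]
    simp only [← Finset.sum_smul]
    have h1 : ∀ k, ∑ α, b j α * e α k = (Pi.single j 1 : κ → ℝ) k := fun k => by
      rw [← hb j]
      simp
    simp [h1, Pi.single_apply]
  refine Weyl.surjective_diracMap_of_bounded_sub
    (q' := q') ((hp'.sub_const t).linear_change e b hrq) hC hC' ?_ ?_ ?_ hinj
  · refine totallyBounded_graphBall_of_le (fun j => ?_) hcpt
    refine ⟨|t| + ∑ α, |b j α|, by positivity, fun x => ?_⟩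
    have h1 : p' j x = t • (x : H) + ∑ α, b j α • q' α x := by
      have h2 := LinearMap.congr_fun (hrq j) x
      simp only [hr, LinearMap.sub_apply, LinearMap.smul_apply, Submodule.subtype_apply,
        LinearMap.sum_apply] at h2
      rw [← h2, add_sub_cancel]
    have h3 : ∀ α, ‖q' α x‖ ≤ ∑ α, ‖q' α x‖ := fun α =>
      Finset.single_le_sum (f := fun α => ‖q' α x‖) (fun _ _ => norm_nonneg _) (Finset.mem_univ α)
    have h4 : ‖∑ α, b j α • q' α x‖ ≤ (∑ α, |b j α|) * ∑ α, ‖q' α x‖ := by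
      refine (norm_sum_le _ _).trans ?_
      rw [Finset.sum_mul]
      refine Finset.sum_le_sum fun α _ => ?_
      rw [norm_smul, Real.norm_eq_abs]
      exact mul_le_mul_of_nonneg_left (h3 α) (abs_nonneg _)
    have h5 : ‖t • (x : H)‖ = |t| * ‖(x : H)‖ := by rw [norm_smul, Real.norm_eq_abs]
    rw [h1]
    refine (norm_add_le _ _).trans ?_
    have h6 : 0 ≤ (∑ α, |b j α|) * ‖(x : H)‖ := by positivity
    have h7 : 0 ≤ |t| * ∑ α, ‖q' α x‖ := by positivity
    rw [h5]
    linarith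
  · intro x hx
    refine ht x fun j => ?_
    have h2 := LinearMap.congr_fun (hrq j) x
    rw [LinearMap.sum_apply] at h2
    rw [show (p' j - t • D.subtype) x = r j x from rfl, h2]
    exact Finset.sum_eq_zero fun α _ => by rw [LinearMap.smul_apply, hx α, smul_zero]
  · intro α
    choose c hc using hbdd
    refine ⟨∑ j, |e α j| * (c j + |t|), fun x => ?_⟩
    simp only [hq', hr, LinearMap.sum_apply, LinearMap.smul_apply]
    rw [← Finset.sum_sub_distrib, Finset.sum_mul]
    refine (norm_sum_le _ _).trans (Finset.sum_le_sum fun j _ => ?_)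
    rw [← smul_sub, norm_smul, Real.norm_eq_abs, mul_assoc]
    refine mul_le_mul_of_nonneg_left ?_ (abs_nonneg _)
    rw [LinearMap.sub_apply, ← sub_add, add_mul]
    refine (norm_add_le _ _).trans (add_le_add (hc j x) ?_)
    rw [LinearMap.smul_apply, norm_smul, Real.norm_eq_abs, Submodule.subtype_apply]

end perturbation

/-! ### The Dirac operator of a representation of the Heisenberg relations -/

section defect

variable {H : Type*} [NormedAddCommGroup H] [InnerProductSpace ℂ H] [CompleteSpace H] {d n : ℕ}
  {θ : Matrix (Fin d) (Fin d) ℝ} {D : Submodule ℂ H} {p : Fin d → D →ₗ[ℂ] H}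
  {W : (Fin d → ℝ) → H →L[ℂ] H} {e : Fin n ⊕ Fin n → Fin d → ℝ}
  {ι : Type*} [Fintype ι] [DecidableEq ι] {C : Fin n ⊕ Fin n → Matrix ι ι ℂ}
  {s s' : Fin n → ι → ℤˣ}

theorem hasGenerator_sum_smul (hW : IsWeylSystem (Matrix.toLinearMap₂' ℝ θ) W)
    (hp : ∀ j (x : D), HasGenerator W (Pi.single j 1) x (p j x)) (z : Fin d → ℝ) (x : D) :
    HasGenerator W z x ((∑ j, z j • p j) x) := by
  simpa using hasGenerator_of_single hW (fun j => hp j x) z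

theorem IsCliffordFamily.eq_zero_of_diracMap_sum_smul_eq_zero (hC : IsCliffordFamily C s s')
    (hs' : ∀ i, ∃ a, s' a i = -1) (hθ : θ.transpose = -θ)
    (hW : IsWeylSystem (Matrix.toLinearMap₂' ℝ θ) W)
    (hp : ∀ j (x : D), HasGenerator W (Pi.single j 1) x (p j x))
    (he : ∀ α β, Matrix.toLinearMap₂' ℝ θ (e α) (e β) = Matrix.J (Fin n) ℝ α β) (ψ : ι → D)
    (hψ : diracMap C (fun α => ∑ j, e α j • p j) ψ = 0) : ψ = 0 := by
  refine hC.eq_zero_of_diracMap_eq_zero hs' (fun α β x y => ?_) hψ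
  have hg := hasGenerator_sum_smul hW hp
  rw [← he]
  exact hW.inner_generator_sub (isAlt_toLinearMap₂' hθ) (hg (e α) x) (hg (e β) x) (hg (e α) y)
    (hg (e β) y)

/-- The vacuum, placed in the spinor component all of whose signs are `1`, is orthogonal to the
range of the Dirac operator. -/
theorem IsCliffordFamily.not_surjective_diracMap_sum_smul [Nontrivial H]
    (hC : IsCliffordFamily C s s') (hs : ∃ i, ∀ a, s a i = 1) (hθ : θ.transpose = -θ)
    (hW : IsWeylSystem (Matrix.toLinearMap₂' ℝ θ) W)
    (hp : ∀ j (x : D), HasGenerator W (Pi.single j 1) x (p j x))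
    (he : ∀ α β, Matrix.toLinearMap₂' ℝ θ (e α) (e β) = Matrix.J (Fin n) ℝ α β) :
    ¬ Function.Surjective (diracMap C fun α => ∑ j, e α j • p j) := by
  intro hsurj
  obtain ⟨i₀, hi₀⟩ := hs
  have hW' := hW.comp (coordinates e) (LinearMap.continuous_of_finiteDimensional _)
  have halt' : ((Matrix.toLinearMap₂' ℝ θ).compl₁₂ (coordinates e) (coordinates e)).IsAlt :=
    fun v => isAlt_toLinearMap₂' hθ _
  obtain ⟨Ω, hΩ0, hΩ⟩ := hW'.exists_isVacuum halt' (compl₁₂_coordinates he)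
    complexStructure_complexStructure
  have hg : ∀ α (x : D), HasGenerator (fun z => W (coordinates e z)) (EuclideanSpace.single α 1)
      x ((∑ j, e α j • p j) x) := by
    intro α x
    have h1 := hasGenerator_sum_smul hW hp (e α) x
    simpa only [HasGenerator, map_smul, coordinates_single] using h1
  obtain ⟨ψ, hψ⟩ := hsurj (WithLp.toLp 2 (Pi.single i₀ Ω))
  have h1 := hC.inner_vacuum_diracMap (p := fun α => ∑ j, e α j • p j) hi₀ (Ω := Ω)
    (fun a x => hW'.inner_vacuum_generator halt' (compl₁₂_coordinates he)
      complexStructure_complexStructure hΩ (u := EuclideanSpace.single (.inr a) 1) (by simp)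
      (by rw [complexStructure_single_inr]; exact hg _ x) (hg _ x)) ψ
  rw [hψ] at h1
  exact hΩ0 (by simpa using h1)

end defect

end Weyl

open Weyl in
theorem proposition3 {d : ℕ} (hd : 2 ≤ d) (θ : Matrix (Fin d) (Fin d) ℝ)
    (hskew : θ.transpose = -θ) (hθ : θ.det ≠ 0)
    {H : Type*} [NormedAddCommGroup H] [InnerProductSpace ℂ H] [CompleteSpace H] [Nontrivial H]
    (P : Fin d → H →ₗ.[ℂ] H) (hP : Weyl.IsHeisenbergRep θ P)
    (hfin : Weyl.HasFiniteMultiplicity θ P) :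
    ¬ ∃ P' : Fin d → H →ₗ.[ℂ] H, Weyl.IsStronglyCommuting P' ∧
        ∀ j, Weyl.HasBoundedDifference (P j) (P' j) := by
  rintro ⟨P', hP', hbdd⟩
  have : Nonempty (Fin d) := ⟨⟨0, by omega⟩⟩
  obtain ⟨n, e, he, hspan⟩ := exists_symplectic_spanning_family (Matrix.toLinearMap₂' ℝ θ)
    (isAlt_toLinearMap₂' hskew) (fun x hx => by
      obtain ⟨y, hy⟩ := (Matrix.nondegenerate_of_det_ne_zero hθ).exists_not_ortho_of_ne_zero hx
      exact ⟨y, by rwa [Matrix.toLinearMap₂'_apply']⟩)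
  obtain ⟨M, K, _, _, _, Q, hQ, hirr, hmul⟩ := hfin
  have hball : ∀ c, TotallyBounded (operatorBall P c) := fun c =>
    hmul.totallyBounded_operatorBall (hQ.totallyBounded_operatorBall hirr hskew he hspan c)
  obtain ⟨W, hW, -, hWP⟩ := hP.exists_isWeylSystem hskew
  -- `d > 0` excludes the empty symplectic basis
  cases n with
  | zero =>
    rw [Set.range_eq_empty, Submodule.span_empty] at hspan
    exact bot_ne_top hspan
  | succ n =>
    obtain ⟨ι, _, _, C, s, s', hC, hs, -, hs'⟩ := exists_isCliffordFamily n
    have hs'' : ∀ i, ∃ a, s' a i = -1 := by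
      intro i
      by_contra! h
      have h1 := hs' i
      rw [Finset.prod_eq_one fun a _ => (Int.units_eq_one_or (s' a i)).resolve_right (h a)] at h1
      exact absurd h1 (by decide)
    let D : Submodule ℂ H := ⨅ j, (P j).domain
    let p : Fin d → D →ₗ[ℂ] H := fun j =>
      (P j).toFun ∘ₗ Submodule.inclusion (iInf_le (fun j => (P j).domain) j)
    let p' : Fin d → D →ₗ[ℂ] H := fun j =>
      (P' j).toFun ∘ₗ Submodule.inclusion
        ((iInf_le (fun j => (P j).domain) j).trans (hbdd j).1.le)
    have hpP : ∀ j (x : D), ((x : H), p j x) ∈ (P j).graph := fun j x =>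
      (P j).mem_graph (Submodule.inclusion (iInf_le (fun j => (P j).domain) j) x)
    have hpP' : ∀ j (x : D), ((x : H), p' j x) ∈ (P' j).graph := fun j x =>
      (P' j).mem_graph (Submodule.inclusion
        ((iInf_le (fun j => (P j).domain) j).trans (hbdd j).1.le) x)
    have hp : ∀ j (x : D), HasGenerator W (Pi.single j 1) x (p j x) := fun j x =>
      (hWP j _ _).1 (hpP j x)
    have hsub : ∀ j, ∃ c : ℝ, ∀ x, ‖p j x - p' j x‖ ≤ c * ‖(x : H)‖ := by
      intro j
      obtain ⟨c, hc⟩ := (hbdd j).2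
      exact ⟨c, fun x => hc (Submodule.inclusion _ x) (Submodule.inclusion _ x) rfl⟩
    have hcomm : IsCommutingTuple p' := by
      refine isCommutingTuple_of_isStronglyCommuting hP' (fun x hx => ?_) hpP'
      exact (Submodule.mem_iInf _).2 fun j => (hbdd j).1 ▸ hx j
    have hcpt : ∀ c, TotallyBounded (graphBall p c) := fun c =>
      (hball c).subset (by
        rintro _ ⟨x, rfl, hx, hxp⟩
        exact ⟨hx, fun j => ⟨p j x, hpP j x, hxp j⟩⟩)
    have hcpt' : ∀ c, TotallyBounded (graphBall p' c) := by
      refine totallyBounded_graphBall_of_le (fun j => ?_) hcpt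
      obtain ⟨c, hc⟩ := hsub j
      refine ⟨|c| + 1, by positivity, fun x => ?_⟩
      have h1 : ‖p' j x‖ ≤ ∑ j, ‖p' j x‖ :=
        Finset.single_le_sum (f := fun j => ‖p' j x‖) (fun _ _ => norm_nonneg _)
          (Finset.mem_univ j)
      have h2 := norm_add_le (p j x - p' j x) (p' j x)
      rw [sub_add_cancel] at h2
      have h3 := mul_le_mul_of_nonneg_right (le_abs_self c) (norm_nonneg (x : H))
      have h4 : 0 ≤ |c| * ∑ j, ‖p' j x‖ := by positivity
      linarith [hc x, norm_nonneg (x : H)]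
    exact hC.not_surjective_diracMap_sum_smul hs hskew hW hp he
      (hcomm.surjective_diracMap_of_bounded_sub hC.conjTranspose_mul hC.mul_conjTranspose hcpt'
        hsub hspan (hC.eq_zero_of_diracMap_sum_smul_eq_zero hs'' hskew hW hp he))
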